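/- **Definitions.** A permutation of size $m$ is a bijection $\sigma:[m]\to[m]$, where $[m]=\{1,\dots,m\}$; write $|\sigma|=m$. If $|\sigma|\le|\tau|$, the density $d(\sigma,\tau)$ is the probability that a uniformly random $|\sigma|$-element set $\{a_1<\dots<a_{|\sigma|}\}\subseteq[|\tau|]$ satisfies $\sigma(i)<\sigma(j)\iff\tau(a_i)<\tau(a_j)$ for all $i,j$; put $d(\sigma,\tau)=0$ if $|\sigma|>|\tau|$. A sequence $(\tau_t)_{t\in\mathbb N}$ of permutations is *quasirandom* if $d(\sigma,\tau_t)\to 1/|\sigma|!$ for every permutation $\sigma$. A set $S$ of permutations is *quasirandom-forcing* if every sequence $(\tau_t)$ of permutations whose sizes tend to infinity is quasirandom if and only if $d(\sigma,\tau_t)\to 1/|\sigma|!$ for every $\sigma\in S$. For $j,j'\in[n-1]$ let $Z^{j,j'}$ be the $n\times n$ matrix with entries $+1$ at $(j,j')$ and $(j+1,j'+1)$, $-1$ at $(j+1,j')$ and $(j,j'+1)$, and $0$ elsewhere. For $x=(x_{j,j'})_{j,j'\in[n-1]}\in\mathbb R^{(n-1)^2}$ let $B(x)$ be the all-one $n\times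 n$ matrix plus $\sum_{j,j'}x_{j,j'}Z^{j,j'}$. For a permutation $\sigma$ define $h^n_\sigma:\mathbb R^{(n-1)^2}\to\mathbb R$ by $$h^n_\sigma(x)=-\frac{n^{2|\sigma|}}{|\sigma|!}+|\sigma|!\sum_{f,g}\frac{\prod_{i\in[|\sigma|]}B(x)_{f(i),g(\sigma(i))}}{\prod_{i\in[n]}|f^{-1}(i)|!\cdot|g^{-1}(i)|!},$$ where $f,g$ range over all non-decreasing functions $[|\sigma|]\to[n]$. Let $\nabla h^n_\sigma$ and $H^n_\sigma$ denote the gradient and the Hessian matrix of $h^n_\sigma$. **Theorem.** Let $k\ge 1$, let $\pi_1,\dots,\pi_k$ be permutations, let $n\in\mathbb N$ satisfy $(n-1)^2\ge k+2$, and let $\alpha_1,\dots,\alpha_k$ be real numbers, not all zero. Suppose that $\nabla h^n_{\pi_1}(\vec 0),\dots,\nabla h^n_{\pi_{k-1}}(\vec 0)$ are linearly independent and that $\alpha_1\nabla h^n_{\pi_1}(\vec 0)+\dots+\alpha_k\nabla h^n_{\pi_k}(\vec 0)=\vec 0$. If there exist vectors $w^+,w^-\in\mathbb R^{(n-1)^2}$,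 both orthogonal to $\nabla h^n_{\pi_i}(\vec 0)$ for every $i\in[k-1]$, such that $$(w^+)^T\Bigl(\sum_{i=1}^k\alpha_iH^n_{\pi_i}(\vec 0)\Bigr)w^+>0\quad\text{and}\quad(w^-)^T\Bigl(\sum_{i=1}^k\alpha_iH^n_{\pi_i}(\vec 0)\Bigr)w^-<0,$$ then $\{\pi_1,\dots,\pi_k\}$ is not quasirandom-forcing. -/

import Mathlib

/-- A permutation of arbitrary finite size: a size `m` together with a bijection of an
`m`-element linear order (positions and values are numbered from `0` to `m - 1`). -/
abbrev FinPerm : Type := Σ m : ℕ, Equiv.Perm (Fin m)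

namespace FinPerm

/-- The size `|σ|` of a permutation. -/
abbrev size (σ : FinPerm) : ℕ := σ.1

/-- `σ` is the subpermutation of `τ` induced by the set `A` of positions: if
`a_0 < a_1 < ...` are the elements of `A`, then there are `|σ|` of them, and
`σ i < σ j` if and only if `τ a_i < τ a_j`. -/
def IsInducedBy (σ τ : FinPerm) (A : Finset (Fin τ.size)) : Prop :=
  ∃ h : A.card = σ.size, ∀ i j : Fin σ.size,
    σ.2 i < σ.2 j ↔ τ.2 (A.orderEmbOfFin h i) < τ.2 (A.orderEmbOfFin h j)

instance (σ τ : FinPerm) (A : Finset (Fin τ.size)) : Decidable (IsInducedBy σ τ A) := by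
  unfold IsInducedBy; infer_instance

/-- The pattern density `d(σ, τ)`: the probability that a uniformly random `|σ|`-element set of
positions of `τ` induces `σ`; it is set to be `0` if `|σ| > |τ|`. -/
noncomputable def density (σ τ : FinPerm) : ℝ :=
  if σ.size ≤ τ.size then
    (((Finset.univ : Finset (Fin τ.size)).powersetCard σ.size).filter
        (fun A => IsInducedBy σ τ A)).card / (τ.size.choose σ.size : ℝ)
  else 0

/-- A sequence of permutations is quasirandom if the density of every permutation `σ` in it
tends to `1 / |σ|!`. -/
def IsQuasirandom (X : ℕ → FinPerm) : Prop :=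
  ∀ σ : FinPerm, Filter.Tendsto (fun t => density σ (X t)) Filter.atTop
    (nhds (1 / (σ.size.factorial : ℝ)))

/-- A set `S` of permutations is quasirandom-forcing if a sequence of permutations whose sizes
tend to infinity is quasirandom if and only if the density of every element `σ` of `S` in it
tends to `1 / |σ|!`. -/
def QuasirandomForcing (S : Set FinPerm) : Prop :=
  ∀ X : ℕ → FinPerm, Filter.Tendsto (fun t => (X t).size) Filter.atTop Filter.atTop →
    (IsQuasirandom X ↔
      ∀ σ ∈ S, Filter.Tendsto (fun t => density σ (X t)) Filter.atTop
        (nhds (1 / (σ.size.factorial : ℝ))))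

/-- `ℝ^{(n-1)^2}` with the Euclidean inner product; coordinates are indexed by pairs
`(j, j')` with `j, j'` in an `(n-1)`-element set. -/
abbrev Param (n : ℕ) : Type := EuclideanSpace ℝ (Fin (n - 1) × Fin (n - 1))

/-- The `n × n` matrix `Z^{j,j'}`: `+1` at `(j,j')` and `(j+1,j'+1)`, `-1` at `(j+1,j')` and
`(j,j'+1)`, and `0` elsewhere. -/
def zMatrix (n : ℕ) (j j' : Fin (n - 1)) : Matrix (Fin n) (Fin n) ℝ :=
  Matrix.of fun i i' =>
    if ((i : ℕ) = j ∧ (i' : ℕ) = j') ∨ ((i : ℕ) = j + 1 ∧ (i' : ℕ) = j' + 1) then 1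
    else if ((i : ℕ) = j + 1 ∧ (i' : ℕ) = j') ∨ ((i : ℕ) = j ∧ (i' : ℕ) = j' + 1) then -1
    else 0

/-- The matrix `B(x)`: the all-one matrix plus the sum of `x_{j,j'} Z^{j,j'}`. -/
noncomputable def bMatrix (n : ℕ) (x : Param n) : Matrix (Fin n) (Fin n) ℝ :=
  Matrix.of (fun _ _ => 1) + ∑ p : Fin (n - 1) × Fin (n - 1), x p • zMatrix n p.1 p.2

/-- The non-decreasing functions from an `m`-element to an `n`-element chain. -/
def monotoneMaps (m n : ℕ) : Finset (Fin m → Fin n) :=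
  Finset.univ.filter fun f => ∀ i j : Fin m, i ≤ j → f i ≤ f j

/-- The number of elements that `f` maps to `i`. -/
def fiberCard {m n : ℕ} (f : Fin m → Fin n) (i : Fin n) : ℕ :=
  (Finset.univ.filter fun a => f a = i).card

/-- The function `h^n_σ : ℝ^{(n-1)^2} → ℝ`. -/
noncomputable def h (n : ℕ) (σ : FinPerm) (x : Param n) : ℝ :=
  -((n : ℝ) ^ (2 * σ.size) / (σ.size.factorial : ℝ)) +
    (σ.size.factorial : ℝ) *
      ∑ f ∈ monotoneMaps σ.size n, ∑ g ∈ monotoneMaps σ.size n,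
        (∏ i : Fin σ.size, bMatrix n x (f i) (g (σ.2 i))) /
          ((∏ i : Fin n, (fiberCard f i).factorial * (fiberCard g i).factorial : ℕ) : ℝ)

/-- The Hessian matrix of `F` at `x`: the entry at `(p, q)` is the second derivative of `F` at
`x` in the directions of the `p`-th and the `q`-th standard basis vector. -/
noncomputable def hessian {ι : Type} [Fintype ι] [DecidableEq ι]
    (F : EuclideanSpace ℝ ι → ℝ) (x : EuclideanSpace ℝ ι) : Matrix ι ι ℝ :=
  Matrix.of fun p q =>
    fderiv ℝ (fderiv ℝ F) x (EuclideanSpace.single p 1) (EuclideanSpace.single q 1)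

end FinPerm

/-! For small `x` the matrix `B(x)` is nonnegative with all row and column sums `n`, so it describes
a step permuton, and `h n σ x` is, up to a positive factor, the density of `σ` in it minus `1 /
|σ|!` (`h_eq_stepDensity`). A nonzero common zero `x` of all `h n (π i)` near `0` therefore refutes
forcing (`not_quasirandomForcing_of_common_zero`): permutations approximating the permuton have the
right limit density of every `π i`, yet are not quasirandom, because some corner of the permuton has
the wrong mass.

Such a zero comes from `exists_ne_zero_common_zero`. Since their gradients are independent, the
first `k - 1` functions cut out a manifold near `0`, tangent to the orthogonal complement of these
gradients. The combination `F` with coefficients `α i` has a critical point at `0`, so along curves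
in the manifold with velocity `w⁺` or `w⁻` it behaves like `s ^ 2 / 2` times its Hessian form. It
takes both signs, hence vanishes at a nonzero point of the manifold. As the last `α i` is nonzero,
the last function vanishes there too.

The approximating permutations are explicit (`exists_isGridPerm`). Pattern counts in them are
bounded only from below; the limits of the bounds add up to `1` over all patterns of a given size,
so the bounds are sharp (`tendsto_density_grid`). Non-quasirandomness is detected by the sum of
squared corner discrepancies, which up to a lower-order error is a combination of counts of patterns
of size 6. -/

/-! ### Symmetrisation: sums over monotone maps and over all maps. -/

open Finset in
/-- The number of permutations that preserve `f`. -/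
lemma card_filter_comp_eq_self {m n : ℕ} (f : Fin m → Fin n) :
    #{p : Equiv.Perm (Fin m) | f ∘ p = f} = ∏ i, (FinPerm.fiberCard f i).factorial := by
  rw [← Fintype.card_subtype, DomMulAct.stabilizer_card]
  simp only [FinPerm.fiberCard, Fintype.card_subtype]

namespace FinPerm

open Finset Filter Topology

lemma mem_monotoneMaps {m n : ℕ} {f : Fin m → Fin n} : f ∈ monotoneMaps m n ↔ Monotone f := by
  simp [monotoneMaps, Monotone]

/-- The product of the factorials of the fibre sizes. -/
def fiberFactorial {m n : ℕ} (f : Fin m → Fin n) : ℕ := ∏ i, (fiberCard f i).factorial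

lemma fiberFactorial_pos {m n : ℕ} (f : Fin m → Fin n) : 0 < fiberFactorial f :=
  Finset.prod_pos fun _ _ => Nat.factorial_pos _

/-- All sorted rearrangements of `f` coincide, so the permutations that sort `f` form a coset of its
stabiliser. -/
lemma card_filter_monotone_comp {m n : ℕ} (f : Fin m → Fin n) :
    #{p : Equiv.Perm (Fin m) | Monotone (f ∘ p)} = fiberFactorial f := by
  rw [fiberFactorial, ← card_filter_comp_eq_self]
  symm
  refine Finset.card_bij' (fun p _ => p * Tuple.sort f) (fun p _ => p * (Tuple.sort f)⁻¹)
    ?_ ?_ (by intros; simp) (by intros; simp)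
  · intro p hp
    simp only [mem_filter, mem_univ, true_and] at hp ⊢
    have : f ∘ ⇑(p * Tuple.sort f) = f ∘ Tuple.sort f := by
      rw [Equiv.Perm.coe_mul, ← Function.comp_assoc, hp]
    rw [this]
    exact Tuple.monotone_sort f
  · intro p hp
    simp only [mem_filter, mem_univ, true_and] at hp ⊢
    have := Tuple.comp_sort_eq_comp_iff_monotone.2 hp
    rw [Equiv.Perm.coe_mul, ← Function.comp_assoc, this]
    ext x
    simp

lemma fiberFactorial_comp_perm {m n : ℕ} (f : Fin m → Fin n) (p : Equiv.Perm (Fin m)) :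
    fiberFactorial (f ∘ p) = fiberFactorial f := by
  unfold fiberFactorial fiberCard
  refine Finset.prod_congr rfl fun i _ => ?_
  congr 1
  refine Finset.card_bij' (fun a _ => p a) (fun a _ => p.symm a) ?_ ?_ ?_ ?_ <;> simp

/-- The sum over all maps of a function that is invariant under permutations of the domain can be
computed from the monotone maps. -/
lemma factorial_mul_sum_monotoneMaps {m n : ℕ} (F : (Fin m → Fin n) → ℝ)
    (hF : ∀ f, ∀ p : Equiv.Perm (Fin m), F (f ∘ p) = F f) :
    (m.factorial : ℝ) * ∑ f ∈ monotoneMaps m n, F f / fiberFactorial f = ∑ f, F f := by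
  -- Double counting of the pairs `(p, f)` with `f ∘ p` monotone: for fixed `p`, reindexing by `f ↦
  -- f ∘ p` gives the monotone sum; for fixed `f` there are `fiberFactorial f` choices of `p`.
  have key : ∀ p : Equiv.Perm (Fin m),
      ∑ f, (if Monotone (f ∘ p) then F f / fiberFactorial f else 0) =
        ∑ f ∈ monotoneMaps m n, F f / fiberFactorial f := by
    intro p
    have : monotoneMaps m n = univ.filter fun f => Monotone f := by
      ext f; simp [mem_monotoneMaps]
    rw [this, Finset.sum_filter]
    refine Fintype.sum_equiv (Equiv.arrowCongr p.symm (Equiv.refl _)) _ _ fun f => ?_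
    have : (Equiv.arrowCongr p.symm (Equiv.refl (Fin n))) f = f ∘ p := by
      ext; simp [Equiv.arrowCongr]
    rw [this, hF, fiberFactorial_comp_perm]
  calc (m.factorial : ℝ) * ∑ f ∈ monotoneMaps m n, F f / fiberFactorial f
      = ∑ p : Equiv.Perm (Fin m),
          ∑ f, (if Monotone (f ∘ p) then F f / fiberFactorial f else 0) := by
        simp_rw [key]
        simp [Finset.card_univ, Fintype.card_perm]
    _ = ∑ f, ∑ p : Equiv.Perm (Fin m),
          (if Monotone (f ∘ p) then F f / fiberFactorial f else 0) := Finset.sum_comm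
    _ = ∑ f, F f := by
        refine Finset.sum_congr rfl fun f _ => ?_
        rw [← Finset.sum_filter, Finset.sum_const, card_filter_monotone_comp, nsmul_eq_mul]
        have := fiberFactorial_pos f
        field_simp

/-! ### Densities in step permutons. -/

/-- The limit density of `σ` in permutations sampled from the step permuton with matrix `B`. -/
noncomputable def stepDensity {n m : ℕ} (B : Matrix (Fin n) (Fin n) ℝ)
    (σ : Equiv.Perm (Fin m)) : ℝ :=
  (m.factorial : ℝ) / (n : ℝ) ^ (2 * m) *
    ∑ f ∈ monotoneMaps m n, ∑ g ∈ monotoneMaps m n,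
      (∏ i, B (f i) (g (σ i))) / (fiberFactorial f * fiberFactorial g)

lemma h_eq_stepDensity {n : ℕ} (hn : 0 < n) (σ : FinPerm) (x : Param n) :
    h n σ x = (n : ℝ) ^ (2 * σ.size) *
      (stepDensity (bMatrix n x) σ.2 - 1 / (σ.size.factorial : ℝ)) := by
  have : (n : ℝ) ≠ 0 := by positivity
  have e : ∀ f g : Fin σ.size → Fin n,
      ((∏ i : Fin n, (fiberCard f i).factorial * (fiberCard g i).factorial : ℕ) : ℝ) =
        fiberFactorial f * fiberFactorial g := by
    intro f g
    rw [Finset.prod_mul_distrib]; push_cast [fiberFactorial]; rfl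
  unfold h stepDensity
  simp_rw [e]
  field_simp
  ring

lemma stepDensity_eq_of_h_eq_zero {n : ℕ} (hn : 0 < n) (σ : FinPerm) (x : Param n)
    (hx : h n σ x = 0) : stepDensity (bMatrix n x) σ.2 = 1 / (σ.size.factorial : ℝ) := by
  rw [h_eq_stepDensity hn] at hx
  have : (n : ℝ) ^ (2 * σ.size) ≠ 0 := by positivity
  have := (mul_eq_zero.1 hx).resolve_left this
  linarith

lemma sum_one_div_fiberFactorial (m n : ℕ) :
    ∑ f ∈ monotoneMaps m n, 1 / (fiberFactorial f : ℝ) = (n : ℝ) ^ m / m.factorial := by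
  have := factorial_mul_sum_monotoneMaps (m := m) (n := n) (fun _ => 1) (fun _ _ => rfl)
  rw [eq_div_iff (by positivity), mul_comm, this]
  simp

lemma stepDensity_one {n m : ℕ} (hn : 0 < n) (σ : Equiv.Perm (Fin m)) :
    stepDensity (Matrix.of fun _ _ : Fin n => 1) σ = 1 / (m.factorial : ℝ) := by
  unfold stepDensity
  have : ∀ f g : Fin m → Fin n, (∏ i, (Matrix.of fun _ _ : Fin n => (1 : ℝ)) (f i) (g (σ i))) /
      (fiberFactorial f * fiberFactorial g : ℝ) =
      1 / (fiberFactorial f : ℝ) * (1 / (fiberFactorial g : ℝ)) := by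
    intro f g; simp; ring
  simp_rw [this, ← Finset.sum_mul_sum, sum_one_div_fiberFactorial]
  have : (n : ℝ) ≠ 0 := by positivity
  field_simp
  ring

lemma bMatrix_zero (n : ℕ) : bMatrix n 0 = Matrix.of fun _ _ : Fin n => 1 := by
  simp [bMatrix]

lemma h_zero {n : ℕ} (hn : 0 < n) (σ : FinPerm) : h n σ 0 = 0 := by
  rw [h_eq_stepDensity hn, bMatrix_zero, stepDensity_one hn, sub_self, mul_zero]

/-- If the entries of `B` sum to `n ^ 2`, then the limit densities of the permutations of a fixed
size add up to `1`. -/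
lemma sum_stepDensity {n m : ℕ} (hn : 0 < n) (B : Matrix (Fin n) (Fin n) ℝ)
    (hB : ∑ i, ∑ j, B i j = (n : ℝ) ^ 2) :
    ∑ σ : Equiv.Perm (Fin m), stepDensity B σ = 1 := by
  have hm : (m.factorial : ℝ) ≠ 0 := by positivity
  have hn' : (n : ℝ) ≠ 0 := by positivity
  -- Summed over `σ`, the product becomes invariant under permuting `f` and `g` separately, so both
  -- monotone sums can be symmetrised. For a single `σ` the sum over all maps is a power of the
  -- total mass.
  let Φ : (Fin m → Fin n) → (Fin m → Fin n) → ℝ := fun f g =>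
    ∑ σ : Equiv.Perm (Fin m), ∏ i, B (f i) (g (σ i))
  have hg : ∀ f g, ∀ p : Equiv.Perm (Fin m), Φ f (g ∘ p) = Φ f g := by
    intro f g p
    refine Fintype.sum_equiv (Equiv.mulLeft p) _ _ fun σ => ?_
    simp
  have hf : ∀ f g, ∀ p : Equiv.Perm (Fin m), Φ (f ∘ p) g = Φ f g := by
    intro f g p
    refine Fintype.sum_equiv (Equiv.mulRight p⁻¹) _ _ fun σ => ?_
    refine Fintype.prod_equiv p _ _ fun i => ?_
    simp
  have hall : ∀ σ : Equiv.Perm (Fin m), ∑ f : Fin m → Fin n, ∑ g : Fin m → Fin n,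
      ∏ i, B (f i) (g (σ i)) = (n : ℝ) ^ (2 * m) := by
    intro σ
    have h1 : ∀ f : Fin m → Fin n, ∑ g : Fin m → Fin n, ∏ i, B (f i) (g (σ i)) =
        ∏ i, ∑ b, B (f i) b := by
      intro f
      rw [Finset.prod_univ_sum, Fintype.piFinset_univ]
      refine Fintype.sum_equiv (Equiv.arrowCongr σ.symm (Equiv.refl _)) _ _ fun g => ?_
      simp [Equiv.arrowCongr]
    simp_rw [h1]
    have := (Finset.prod_univ_sum (fun _ : Fin m => (univ : Finset (Fin n)))
      (fun _ a => ∑ b, B a b)).symm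
    rw [Fintype.piFinset_univ] at this
    rw [this, hB]
    simp [pow_mul]
  have hsum : (m.factorial : ℝ) * ((m.factorial : ℝ) * ∑ f ∈ monotoneMaps m n,
      ∑ g ∈ monotoneMaps m n, Φ f g / (fiberFactorial f * fiberFactorial g)) =
      m.factorial * (n : ℝ) ^ (2 * m) := by
    have h1 : ∀ f, ∑ g ∈ monotoneMaps m n, Φ f g / (fiberFactorial f * fiberFactorial g) =
        ((∑ g, Φ f g) / m.factorial) / fiberFactorial f := by
      intro f
      rw [← factorial_mul_sum_monotoneMaps (Φ f) (hg f), mul_div_cancel_left₀ _ hm,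
        Finset.sum_div]
      refine Finset.sum_congr rfl fun g _ => ?_
      rw [div_div, mul_comm]
    simp_rw [h1]
    rw [factorial_mul_sum_monotoneMaps (fun f => (∑ g, Φ f g) / m.factorial)
      (fun f p => by simp only [hf]), ← Finset.sum_div, mul_div_cancel₀ _ hm]
    have : ∑ f, ∑ g, Φ f g = ∑ σ : Equiv.Perm (Fin m), ∑ f : Fin m → Fin n,
        ∑ g : Fin m → Fin n, ∏ i, B (f i) (g (σ i)) := by
      simp only [Φ]
      rw [Finset.sum_comm]
      simp_rw [fun g : Fin m → Fin n => Finset.sum_comm (s := (univ : Finset (Fin m → Fin n)))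
        (t := (univ : Finset (Equiv.Perm (Fin m)))) (f := fun f σ => ∏ i, B (f i) (g (σ i)))]
      rw [Finset.sum_comm]
      refine Finset.sum_congr rfl fun σ _ => Finset.sum_comm
    rw [this]
    simp_rw [hall]
    simp [Finset.card_univ, Fintype.card_perm]
  have hD : ∑ σ : Equiv.Perm (Fin m), stepDensity B σ = (m.factorial : ℝ) / (n : ℝ) ^ (2 * m) *
      ∑ f ∈ monotoneMaps m n, ∑ g ∈ monotoneMaps m n,
        Φ f g / (fiberFactorial f * fiberFactorial g) := by
    unfold stepDensity
    rw [← Finset.mul_sum, Finset.sum_comm]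
    congr 1
    refine Finset.sum_congr rfl fun f _ => ?_
    rw [Finset.sum_comm]
    simp only [Φ, Finset.sum_div]
  have hsum' := mul_left_cancel₀ hm hsum
  rw [hD, div_mul_eq_mul_div, hsum', div_self (by positivity)]

/-- The maps `u` that are strictly increasing on the fibres of `f`. -/
def fiberStrictMaps {m n : ℕ} (f : Fin m → Fin n) (t : ℕ) : Finset (Fin m → Fin t) :=
  univ.filter fun u => ∀ i j, i < j → f i = f j → u i < u j

lemma mem_fiberStrictMaps {m n t : ℕ} {f : Fin m → Fin n} {u : Fin m → Fin t} :
    u ∈ fiberStrictMaps f t ↔ ∀ i j, i < j → f i = f j → u i < u j := by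
  simp [fiberStrictMaps]

/-- Sorting an injective `u` by the pairs `(f i, u i)` gives a permutation `p` that fixes the
monotone map `f` and makes `u ∘ p` strict on its fibres. Hence the pairs (stabiliser element, strict
map) surject onto the injective maps. -/
lemma descFactorial_le_fiberFactorial_mul {m n : ℕ} {f : Fin m → Fin n} (hf : Monotone f)
    (t : ℕ) : t.descFactorial m ≤ fiberFactorial f * #(fiberStrictMaps f t) := by
  have h1 : t.descFactorial m = #{u : Fin m → Fin t | Function.Injective u} := by
    rw [← Fintype.card_subtype, Fintype.card_congr (Equiv.subtypeInjectiveEquivEmbedding _ _),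
      Fintype.card_embedding_eq]
    simp
  rw [h1, fiberFactorial, ← card_filter_comp_eq_self, ← Finset.card_product]
  refine Finset.card_le_card_of_surjOn (fun q => q.2 ∘ q.1.symm) ?_
  intro u hu
  have hu : Function.Injective u := by simpa using hu
  let v : Fin m → Fin n ×ₗ Fin t := fun i => toLex (f i, u i)
  have hv := Tuple.monotone_sort v
  set p := Tuple.sort v
  have hfp : Monotone (f ∘ p) := fun i j hij => by
    have := Prod.Lex.monotone_fst_ofLex (hv hij)
    simpa [v] using this
  have hfp' : f ∘ p = f := by
    have := Tuple.unique_monotone (f := f) (σ := p) (τ := Equiv.refl _) hfp (by simpa using hf)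
    simpa using this
  refine ⟨(p, u ∘ p), ?_, by ext; simp⟩
  simp only [coe_product, Set.mem_prod, mem_coe, mem_filter, mem_univ, true_and,
    mem_fiberStrictMaps]
  refine ⟨hfp', fun i j hij hfij => ?_⟩
  have h2 : v (p i) ≤ v (p j) := hv hij.le
  have hfij' : f (p i) = f (p j) := by
    exact (congrFun hfp' i).trans (hfij.trans (congrFun hfp' j).symm)
  have h3 : u (p i) ≤ u (p j) := by
    rcases Prod.Lex.toLex_le_toLex.1 h2 with h | h
    · exact absurd hfij' (ne_of_lt h)
    · exact h.2
  exact lt_of_le_of_ne h3 fun h => hij.ne (p.injective (hu h))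

end FinPerm

/-! ### Occurrences of patterns and grid permutations. -/

namespace FinPerm

open Finset Filter Topology

/-- The occurrences of the pattern `σ` in `τ`, as increasing enumerations of positions. -/
def occurrences {m N : ℕ} (σ : Equiv.Perm (Fin m)) (τ : Equiv.Perm (Fin N)) :
    Finset (Fin m → Fin N) :=
  univ.filter fun φ => StrictMono φ ∧ ∀ i j, σ i < σ j ↔ τ (φ i) < τ (φ j)

lemma mem_occurrences {m N : ℕ} {σ : Equiv.Perm (Fin m)} {τ : Equiv.Perm (Fin N)}
    {φ : Fin m → Fin N} :
    φ ∈ occurrences σ τ ↔ StrictMono φ ∧ ∀ i j, σ i < σ j ↔ τ (φ i) < τ (φ j) := by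
  simp [occurrences]

lemma card_image_of_strictMono {m N : ℕ} {φ : Fin m → Fin N} (hφ : StrictMono φ) :
    #(univ.image φ) = m := by
  rw [Finset.card_image_of_injective _ hφ.injective, Finset.card_univ, Fintype.card_fin]

lemma orderEmbOfFin_image {m N : ℕ} {φ : Fin m → Fin N} (hφ : StrictMono φ)
    (hc : #(univ.image φ) = m) : ⇑((univ.image φ).orderEmbOfFin hc) = φ :=
  (Finset.orderEmbOfFin_unique hc (fun x => Finset.mem_image_of_mem φ (mem_univ x)) hφ).symm

lemma image_orderEmbOfFin {m N : ℕ} {A : Finset (Fin N)} (hc : #A = m) :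
    univ.image (A.orderEmbOfFin hc) = A := by
  apply Finset.coe_injective
  simp

lemma injOn_image_strictMono {m N : ℕ} :
    Set.InjOn (fun φ : Fin m → Fin N => univ.image φ) {φ | StrictMono φ} := by
  intro φ hφ ψ hψ h
  refine (hφ.range_inj hψ).1 ?_
  simpa using congrArg (fun A : Finset (Fin N) => (A : Set (Fin N))) h

lemma card_strictMono (m N : ℕ) : #{φ : Fin m → Fin N | StrictMono φ} = N.choose m := by
  have : N.choose m = #((univ : Finset (Fin N)).powersetCard m) := by simp
  rw [this]
  refine Finset.card_bij (fun φ _ => univ.image φ) ?_ ?_ ?_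
  · intro φ hφ
    exact mem_powersetCard.2 ⟨subset_univ _, card_image_of_strictMono (by simpa using hφ)⟩
  · intro φ hφ ψ hψ h
    exact injOn_image_strictMono (by simpa using hφ) (by simpa using hψ) h
  · intro A hA
    have hc := (mem_powersetCard.1 hA).2
    exact ⟨A.orderEmbOfFin hc, by simpa using (A.orderEmbOfFin hc).strictMono,
      image_orderEmbOfFin hc⟩

lemma card_occurrences {m N : ℕ} (σ : Equiv.Perm (Fin m)) (τ : Equiv.Perm (Fin N)) :
    #(occurrences σ τ) = #(((univ : Finset (Fin N)).powersetCard m).filter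
      (fun A => IsInducedBy ⟨m, σ⟩ ⟨N, τ⟩ A)) := by
  refine Finset.card_bij (fun φ _ => univ.image φ) ?_ ?_ ?_
  · intro φ hφ
    obtain ⟨h1, h2⟩ := mem_occurrences.1 hφ
    refine mem_filter.2 ⟨mem_powersetCard.2 ⟨subset_univ _, card_image_of_strictMono h1⟩,
      card_image_of_strictMono h1, fun i j => ?_⟩
    rw [orderEmbOfFin_image h1 (card_image_of_strictMono h1)]
    exact h2 i j
  · intro φ hφ ψ hψ h
    exact injOn_image_strictMono (mem_occurrences.1 hφ).1 (mem_occurrences.1 hψ).1 h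
  · intro A hA
    obtain ⟨hc, hA⟩ := (mem_filter.1 hA).2
    exact ⟨A.orderEmbOfFin hc, mem_occurrences.2 ⟨(A.orderEmbOfFin hc).strictMono, hA⟩,
      image_orderEmbOfFin hc⟩

lemma density_eq_card_occurrences {m N : ℕ} (hmN : m ≤ N) (σ : Equiv.Perm (Fin m))
    (τ : Equiv.Perm (Fin N)) :
    density ⟨m, σ⟩ ⟨N, τ⟩ = #(occurrences σ τ) / (N.choose m : ℝ) := by
  rw [card_occurrences, density, if_pos hmN]

/-- `σ ∘ σ'⁻¹` is an increasing permutation of a finite chain, hence the identity. -/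
lemma eq_of_lt_iff_lt {m : ℕ} {σ σ' : Equiv.Perm (Fin m)}
    (h : ∀ i j, σ i < σ j ↔ σ' i < σ' j) : σ = σ' := by
  have hmono : StrictMono (σ ∘ σ'.symm) := fun i j hij => by
    simpa using (h (σ'.symm i) (σ'.symm j)).2 (by simpa using hij)
  have := Tuple.unique_monotone (f := id) (σ := σ'.symm.trans σ) (τ := Equiv.refl _)
    hmono.monotone monotone_id
  ext i
  have := congrFun this (σ' i)
  simpa using congrArg Fin.val this

/-- Each increasing enumeration is an occurrence of exactly one pattern. -/
lemma exists_filter_mem_occurrences {m N : ℕ} (τ : Equiv.Perm (Fin N)) {φ : Fin m → Fin N}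
    (hφ : StrictMono φ) : ∃ σ : Equiv.Perm (Fin m), φ ∈ occurrences σ τ ∧
      ({σ' | φ ∈ occurrences σ' τ} : Finset (Equiv.Perm (Fin m))) = {σ} := by
  set s := Tuple.sort (τ ∘ φ)
  have hs : StrictMono ((τ ∘ φ) ∘ s) := (Tuple.monotone_sort (τ ∘ φ)).strictMono_of_injective
    ((τ.injective.comp hφ.injective).comp s.injective)
  -- The pattern of a tuple is the inverse of the permutation that sorts its values.
  have hmem : φ ∈ occurrences s⁻¹ τ := by
    refine mem_occurrences.2 ⟨hφ, fun i j => ?_⟩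
    rw [← hs.lt_iff_lt]; simp
  refine ⟨s⁻¹, hmem, ?_⟩
  ext σ'
  simp only [mem_filter, mem_univ, true_and, mem_singleton]
  refine ⟨fun hσ' => eq_of_lt_iff_lt fun i j => ?_, fun h => h ▸ hmem⟩
  rw [(mem_occurrences.1 hσ').2, ← hs.lt_iff_lt]; simp

lemma sum_card_filter_occurrences {m N : ℕ} (τ : Equiv.Perm (Fin N))
    (F : Equiv.Perm (Fin m) → (Fin m → Fin N) → ℝ) :
    ∑ σ, ∑ φ ∈ occurrences σ τ, F σ φ =
      ∑ φ with StrictMono φ, ∑ σ with φ ∈ occurrences σ τ, F σ φ := by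
  refine Finset.sum_comm' fun σ φ => ?_
  simp only [mem_univ, true_and, mem_filter]
  exact ⟨fun h => ⟨h, (mem_occurrences.1 h).1⟩, fun h => h.1⟩

lemma sum_card_occurrences {m N : ℕ} (τ : Equiv.Perm (Fin N)) :
    ∑ σ : Equiv.Perm (Fin m), #(occurrences σ τ) = N.choose m := by
  have h := sum_card_filter_occurrences (m := m) τ (fun _ _ => 1)
  have h1 : ∀ φ ∈ ({φ : Fin m → Fin N | StrictMono φ} : Finset _),
      ∑ σ : Equiv.Perm (Fin m) with φ ∈ occurrences σ τ, (1 : ℝ) = 1 := by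
    intro φ hφ
    obtain ⟨σ, -, hσ⟩ := exists_filter_mem_occurrences τ (φ := φ) (by simpa using hφ)
    rw [hσ]; simp
  rw [Finset.sum_congr rfl h1] at h
  simp only [sum_const, nsmul_eq_mul, mul_one, card_strictMono] at h
  exact_mod_cast h

lemma sum_density {m N : ℕ} (hmN : m ≤ N) (τ : Equiv.Perm (Fin N)) :
    ∑ σ : Equiv.Perm (Fin m), density ⟨m, σ⟩ ⟨N, τ⟩ = 1 := by
  simp_rw [density_eq_card_occurrences hmN]
  rw [← Finset.sum_div, ← Nat.cast_sum, sum_card_occurrences,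
    div_self (by exact_mod_cast (Nat.choose_pos hmN).ne')]

lemma exists_equiv_monotone {P R : Type*} [Fintype P] [LinearOrder R] (row : P → R) :
    ∃ e : Fin (Fintype.card P) ≃ P, Monotone (row ∘ e) :=
  ⟨(Tuple.sort (row ∘ (Fintype.equivFin P).symm)).trans (Fintype.equivFin P).symm, by
    simpa [Function.comp_assoc] using Tuple.monotone_sort (row ∘ (Fintype.equivFin P).symm)⟩

/-- The points of an `n × n` grid of cells, each of which is a `t × t` grid of boxes, where each
box of the cell `(a, b)` holds `N a b` points. -/
abbrev GridPoint {n : ℕ} (N : Matrix (Fin n) (Fin n) ℕ) (t : ℕ) : Type :=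
  Σ z : (Fin n × Fin t) × (Fin n × Fin t), Fin (N z.1.1 z.2.1)

/-- The row of a point. -/
def GridPoint.row {n : ℕ} {N : Matrix (Fin n) (Fin n) ℕ} {t : ℕ} (p : GridPoint N t) :
    Fin n ×ₗ Fin t := toLex p.1.1

/-- The column of a point. -/
def GridPoint.col {n : ℕ} {N : Matrix (Fin n) (Fin n) ℕ} {t : ℕ} (p : GridPoint N t) :
    Fin n ×ₗ Fin t := toLex p.1.2

/-- The permutation `τ` lists the points of the grid in an order compatible with the rows and the
columns. -/
structure IsGridPerm {n : ℕ} (N : Matrix (Fin n) (Fin n) ℕ) (t : ℕ) {M : ℕ}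
    (τ : Equiv.Perm (Fin M)) (e : Fin M ≃ GridPoint N t) : Prop where
  lt_of_row_lt : ∀ i j, GridPoint.row (e i) < GridPoint.row (e j) → i < j
  lt_of_col_lt : ∀ i j, GridPoint.col (e i) < GridPoint.col (e j) → τ i < τ j

/-- The points are listed once by row and once by column, with arbitrary tie-breaking; `τ`
translates the first list into the second. -/
lemma exists_isGridPerm {n : ℕ} (N : Matrix (Fin n) (Fin n) ℕ) (t : ℕ) :
    ∃ (τ : Equiv.Perm (Fin (Fintype.card (GridPoint N t))))
      (e : Fin (Fintype.card (GridPoint N t)) ≃ GridPoint N t), IsGridPerm N t τ e := by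
  obtain ⟨e₁, h₁⟩ := exists_equiv_monotone (GridPoint.row (N := N) (t := t))
  obtain ⟨e₂, h₂⟩ := exists_equiv_monotone (GridPoint.col (N := N) (t := t))
  refine ⟨e₁.trans e₂.symm, e₁, fun i j hij => ?_, fun i j hij => ?_⟩
  · by_contra! hji
    exact absurd (h₁ hji) (not_le.2 hij)
  · by_contra! hji
    have := h₂ hji
    simp only [Function.comp_apply, Equiv.trans_apply, Equiv.apply_symm_apply] at this
    exact absurd this (not_le.2 hij)

lemma card_filter_fst_eq {n t : ℕ} (N : Matrix (Fin n) (Fin n) ℕ)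
    (z : (Fin n × Fin t) × (Fin n × Fin t)) :
    #{p : GridPoint N t | p.1 = z} = N z.1.1 z.2.1 := by
  rw [← Fintype.card_subtype, Fintype.card_congr (Equiv.sigmaSubtype z), Fintype.card_fin]

lemma card_gridPoint {n t : ℕ} (N : Matrix (Fin n) (Fin n) ℕ) :
    Fintype.card (GridPoint N t) = t ^ 2 * ∑ a, ∑ b, N a b := by
  rw [Fintype.card_sigma]
  simp only [Fintype.card_fin, Fintype.sum_prod_type, sum_const, card_univ, smul_eq_mul,
    ← Finset.mul_sum]
  ring

/-- The left side counts the tuples of points lying in distinct rows and distinct columns in the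
pattern `σ`. Their relative order does not depend on how ties are broken. -/
lemma sum_le_card_occurrences {n t m M : ℕ} {N : Matrix (Fin n) (Fin n) ℕ}
    {τ : Equiv.Perm (Fin M)} {e : Fin M ≃ GridPoint N t} (hτ : IsGridPerm N t τ e)
    (σ : Equiv.Perm (Fin m)) :
    ∑ f ∈ monotoneMaps m n, ∑ g ∈ monotoneMaps m n,
      #(fiberStrictMaps f t) * #(fiberStrictMaps g t) * ∏ i, N (f i) (g (σ i)) ≤
        #(occurrences σ τ) := by
  let I : Finset (((Fin m → Fin n) × (Fin m → Fin n)) × ((Fin m → Fin t) × (Fin m → Fin t))) :=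
    univ.filter fun q => (Monotone q.1.1 ∧ Monotone q.1.2) ∧
      (q.2.1 ∈ fiberStrictMaps q.1.1 t ∧ q.2.2 ∈ fiberStrictMaps q.1.2 t)
  -- The box of the `i`-th point. Column data are indexed by the rank of the value, hence evaluated
  -- at `σ i`.
  let z : (((Fin m → Fin n) × (Fin m → Fin n)) × ((Fin m → Fin t) × (Fin m → Fin t))) →
      Fin m → (Fin n × Fin t) × (Fin n × Fin t) :=
    fun q i => ((q.1.1 i, q.2.1 i), (q.1.2 (σ i), q.2.2 (σ i)))
  have hz : Function.Injective z := by
    intro q q' h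
    have h1 : ∀ i, ((q.1.1 i, q.2.1 i), (q.1.2 (σ i), q.2.2 (σ i))) =
        ((q'.1.1 i, q'.2.1 i), (q'.1.2 (σ i), q'.2.2 (σ i))) := fun i => congrFun h i
    simp only [Prod.mk.injEq] at h1
    refine Prod.ext (Prod.ext (funext fun i => (h1 i).1.1) (funext fun i => ?_))
      (Prod.ext (funext fun i => (h1 i).1.2) (funext fun i => ?_))
    · simpa using (h1 (σ.symm i)).2.1
    · simpa using (h1 (σ.symm i)).2.2
  let S : (((Fin m → Fin n) × (Fin m → Fin n)) × ((Fin m → Fin t) × (Fin m → Fin t))) →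
      Finset (Fin m → GridPoint N t) :=
    fun q => Fintype.piFinset fun i => univ.filter fun p => p.1 = z q i
  have hS : ∀ q φ, φ ∈ S q ↔ ∀ i, (φ i).1 = z q i := by
    intro q φ; simp [S]
  have hcard : #(I.biUnion S) = ∑ f ∈ monotoneMaps m n, ∑ g ∈ monotoneMaps m n,
      #(fiberStrictMaps f t) * #(fiberStrictMaps g t) * ∏ i, N (f i) (g (σ i)) := by
    rw [Finset.card_biUnion]
    · have h1 : ∀ q, #(S q) = ∏ i, N (q.1.1 i) (q.1.2 (σ i)) := by
        intro q
        rw [Fintype.card_piFinset]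
        exact Finset.prod_congr rfl fun i _ => card_filter_fst_eq N (z q i)
      simp_rw [h1]
      rw [← Finset.sum_product', Finset.sum_finset_product' I
        (monotoneMaps m n ×ˢ monotoneMaps m n)
        (fun fg => fiberStrictMaps fg.1 t ×ˢ fiberStrictMaps fg.2 t)
        (by intro q; simp [I, mem_monotoneMaps])
        (f := fun fg _ => ∏ i, N (fg.1 i) (fg.2 (σ i)))]
      refine Finset.sum_congr rfl fun fg _ => ?_
      rw [Finset.sum_const, Finset.card_product, smul_eq_mul]
    · intro q _ q' _ hqq'
      refine Finset.disjoint_left.2 fun φ h h' => hqq' (hz (funext fun i => ?_))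
      rw [← (hS q φ).1 h i, (hS q' φ).1 h' i]
  rw [← hcard]
  refine Finset.card_le_card_of_injOn (fun φ i => e.symm (φ i)) ?_ ?_
  · intro φ hφ
    obtain ⟨q, hq, hφ⟩ := Finset.mem_biUnion.1 hφ
    have hφ := (hS q φ).1 hφ
    obtain ⟨⟨hf, hg⟩, hu, hv⟩ := (mem_filter.1 hq).2
    have hlex : ∀ (f : Fin m → Fin n) (u : Fin m → Fin t), Monotone f →
        u ∈ fiberStrictMaps f t → ∀ i j, i < j →
          (toLex (f i, u i) : Fin n ×ₗ Fin t) < toLex (f j, u j) := by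
      intro f u hf hu i j hij
      rw [Prod.Lex.toLex_lt_toLex]
      rcases (hf hij.le).lt_or_eq with h | h
      · exact Or.inl h
      · exact Or.inr ⟨h, mem_fiberStrictMaps.1 hu i j hij h⟩
    have hcol : ∀ i j, σ i < σ j → τ (e.symm (φ i)) < τ (e.symm (φ j)) := by
      intro i j hij
      refine hτ.lt_of_col_lt _ _ ?_
      simp only [Equiv.apply_symm_apply, GridPoint.col, hφ, z]
      exact hlex _ _ hg hv _ _ hij
    refine mem_occurrences.2 ⟨fun i j hij => hτ.lt_of_row_lt _ _ ?_, fun i j => ⟨hcol i j, ?_⟩⟩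
    · simp only [Equiv.apply_symm_apply, GridPoint.row, hφ, z]
      exact hlex _ _ hf hu _ _ hij
    · intro h
      by_contra! hji
      rcases hji.lt_or_eq with h' | h'
      · exact absurd (hcol j i h') (not_lt.2 h.le)
      · rw [σ.injective h'] at h
        exact lt_irrefl _ h
  · intro φ _ ψ _ h
    funext i
    exact e.symm.injective (congrFun h i)

end FinPerm

/-! ### Limit densities of grid permutations. -/

namespace FinPerm

open Finset Filter Topology

/-- The integer matrix obtained by scaling `B` by `t` and rounding down. -/
noncomputable def floorMatrix {n : ℕ} (B : Matrix (Fin n) (Fin n) ℝ) (t : ℕ) :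
    Matrix (Fin n) (Fin n) ℕ :=
  Matrix.of fun a b => ⌊B a b * t⌋₊

lemma tendsto_floorMatrix_div {n : ℕ} {B : Matrix (Fin n) (Fin n) ℝ} (hB : ∀ a b, 0 ≤ B a b)
    (a b : Fin n) : Tendsto (fun t : ℕ => (floorMatrix B t a b : ℝ) / t) atTop (𝓝 (B a b)) :=
  (tendsto_nat_floor_mul_div_atTop (hB a b)).comp tendsto_natCast_atTop_atTop

lemma floorMatrix_le {n : ℕ} {B : Matrix (Fin n) (Fin n) ℝ} (hB : ∀ a b, 0 ≤ B a b)
    (t : ℕ) (a b : Fin n) : (floorMatrix B t a b : ℝ) ≤ B a b * t :=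
  Nat.floor_le (mul_nonneg (hB a b) (Nat.cast_nonneg t))

/-- Rounding down makes this valid for every `t`; it bounds the binomial coefficient in the density
from above. -/
lemma card_gridPoint_floorMatrix_le {n : ℕ} {B : Matrix (Fin n) (Fin n) ℝ}
    (hB : ∀ a b, 0 ≤ B a b) (hsum : ∑ a, ∑ b, B a b = (n : ℝ) ^ 2) (t : ℕ) :
    (Fintype.card (GridPoint (floorMatrix B t) t) : ℝ) ≤ (t : ℝ) ^ 3 * (n : ℝ) ^ 2 := by
  rw [card_gridPoint]
  push_cast
  calc (t : ℝ) ^ 2 * ∑ a, ∑ b, (floorMatrix B t a b : ℝ)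
      ≤ (t : ℝ) ^ 2 * ∑ a, ∑ b, B a b * t := by
        gcongr with a _ b _
        exact floorMatrix_le hB t a b
    _ = (t : ℝ) ^ 3 * (n : ℝ) ^ 2 := by
        simp_rw [← Finset.sum_mul]
        rw [hsum]; ring

lemma tendsto_descFactorial_div_pow (m : ℕ) :
    Tendsto (fun t : ℕ => (t.descFactorial m : ℝ) / (t : ℝ) ^ m) atTop (𝓝 1) := by
  refine (Asymptotics.isEquivalent_iff_tendsto_one ?_).1 (isEquivalent_descFactorial m)
  filter_upwards [eventually_gt_atTop 0] with t ht
  positivity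

lemma tendsto_card_gridPoint_div {n : ℕ} {B : Matrix (Fin n) (Fin n) ℝ}
    (hB : ∀ a b, 0 ≤ B a b) (hsum : ∑ a, ∑ b, B a b = (n : ℝ) ^ 2) :
    Tendsto (fun t : ℕ => (Fintype.card (GridPoint (floorMatrix B t) t) : ℝ) / (t : ℝ) ^ 3) atTop
      (𝓝 ((n : ℝ) ^ 2)) := by
  have h : Tendsto (fun t : ℕ => ∑ a, ∑ b, (floorMatrix B t a b : ℝ) / t) atTop
      (𝓝 (∑ a, ∑ b, B a b)) :=
    tendsto_finsetSum _ fun a _ => tendsto_finsetSum _ fun b _ => tendsto_floorMatrix_div hB a b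
  rw [hsum] at h
  refine h.congr' ?_
  filter_upwards [eventually_gt_atTop 0] with t ht
  rw [card_gridPoint]
  push_cast
  simp_rw [← Finset.sum_div]
  have : (t : ℝ) ≠ 0 := by positivity
  field_simp

lemma tendsto_card_gridPoint {n : ℕ} (hn : 0 < n) {B : Matrix (Fin n) (Fin n) ℝ}
    (hB : ∀ a b, 0 ≤ B a b) (hsum : ∑ a, ∑ b, B a b = (n : ℝ) ^ 2) :
    Tendsto (fun t : ℕ => Fintype.card (GridPoint (floorMatrix B t) t)) atTop atTop := by
  rw [← tendsto_natCast_atTop_iff (R := ℝ)]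
  have h3 : Tendsto (fun t : ℕ => (t : ℝ) ^ 3) atTop atTop :=
    (tendsto_pow_atTop (by norm_num)).comp tendsto_natCast_atTop_atTop
  refine ((tendsto_card_gridPoint_div hB hsum).pos_mul_atTop (by positivity) h3).congr' ?_
  filter_upwards [eventually_gt_atTop 0] with t ht
  have : (t : ℝ) ≠ 0 := by positivity
  field_simp

/-- A lower bound for the density of `σ` in the grid permutations of `floorMatrix B t`. -/
noncomputable def gridDensity {n m : ℕ} (B : Matrix (Fin n) (Fin n) ℝ)
    (σ : Equiv.Perm (Fin m)) (t : ℕ) : ℝ :=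
  (m.factorial : ℝ) / (n : ℝ) ^ (2 * m) *
    ∑ f ∈ monotoneMaps m n, ∑ g ∈ monotoneMaps m n,
      (((t.descFactorial m : ℝ) / (t : ℝ) ^ m) ^ 2 * ∏ i, (floorMatrix B t (f i) (g (σ i)) : ℝ) / t)
        / (fiberFactorial f * fiberFactorial g)

lemma tendsto_gridDensity {n m : ℕ} {B : Matrix (Fin n) (Fin n) ℝ}
    (hB : ∀ a b, 0 ≤ B a b) (σ : Equiv.Perm (Fin m)) :
    Tendsto (gridDensity B σ) atTop (𝓝 (stepDensity B σ)) := by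
  refine Tendsto.const_mul _ (tendsto_finsetSum _ fun f _ => tendsto_finsetSum _ fun g _ =>
    Tendsto.div_const ?_ _)
  have := ((tendsto_descFactorial_div_pow m).pow 2).mul
    (tendsto_finsetProd univ fun i _ => tendsto_floorMatrix_div hB (f i) (g (σ i)))
  simpa using this

lemma gridDensity_le_density {n m M t : ℕ} (hn : 0 < n) (ht : 0 < t) (hmM : m ≤ M)
    {B : Matrix (Fin n) (Fin n) ℝ} (hB : ∀ a b, 0 ≤ B a b)
    (hsum : ∑ a, ∑ b, B a b = (n : ℝ) ^ 2) {τ : Equiv.Perm (Fin M)}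
    {e : Fin M ≃ GridPoint (floorMatrix B t) t} (hτ : IsGridPerm _ t τ e)
    (σ : Equiv.Perm (Fin m)) : gridDensity B σ t ≤ density ⟨m, σ⟩ ⟨M, τ⟩ := by
  have htR : (0 : ℝ) < t := by exact_mod_cast ht
  have hnR : (0 : ℝ) < n := by exact_mod_cast hn
  have hM : (M : ℝ) ≤ (t : ℝ) ^ 3 * (n : ℝ) ^ 2 := by
    have := card_gridPoint_floorMatrix_le hB hsum t
    rwa [← Fintype.card_congr e, Fintype.card_fin] at this
  have hchoose : (M.choose m : ℝ) ≤ ((t : ℝ) ^ 3 * (n : ℝ) ^ 2) ^ m / m.factorial :=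
    (Nat.choose_le_pow_div m M).trans (by gcongr)
  have hpos : (0 : ℝ) < M.choose m := by exact_mod_cast Nat.choose_pos hmM
  rw [density_eq_card_occurrences hmM, le_div_iff₀ hpos]
  have hE : ∀ f ∈ monotoneMaps m n,
      (t.descFactorial m : ℝ) / fiberFactorial f ≤ #(fiberStrictMaps f t) := by
    intro f hf
    have := fiberFactorial_pos f
    rw [div_le_iff₀ (by positivity), mul_comm]
    exact_mod_cast descFactorial_le_fiberFactorial_mul (mem_monotoneMaps.1 hf) t
  have hnonneg : 0 ≤ gridDensity B σ t := by unfold gridDensity; positivity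
  calc gridDensity B σ t * (M.choose m : ℝ)
      ≤ gridDensity B σ t * (((t : ℝ) ^ 3 * (n : ℝ) ^ 2) ^ m / m.factorial) := by gcongr
    _ = ∑ f ∈ monotoneMaps m n, ∑ g ∈ monotoneMaps m n,
          ((t.descFactorial m : ℝ) / fiberFactorial f) *
          ((t.descFactorial m : ℝ) / fiberFactorial g) *
            ∏ i, (floorMatrix B t (f i) (g (σ i)) : ℝ) := by
        unfold gridDensity
        rw [mul_right_comm, Finset.mul_sum]
        refine Finset.sum_congr rfl fun f _ => ?_
        rw [Finset.mul_sum]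
        refine Finset.sum_congr rfl fun g _ => ?_
        rw [Finset.prod_div_distrib, Finset.prod_const, Finset.card_univ, Fintype.card_fin]
        have h1 := fiberFactorial_pos f
        have h2 := fiberFactorial_pos g
        field_simp
        ring
    _ ≤ ∑ f ∈ monotoneMaps m n, ∑ g ∈ monotoneMaps m n,
          (#(fiberStrictMaps f t) : ℝ) * #(fiberStrictMaps g t) *
            ∏ i, (floorMatrix B t (f i) (g (σ i)) : ℝ) := by
        refine Finset.sum_le_sum fun f hf => Finset.sum_le_sum fun g hg => ?_
        have := hE f hf
        have := hE g hg
        gcongr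
    _ ≤ #(occurrences σ τ) := by exact_mod_cast sum_le_card_occurrences hτ σ

/-- The lower bounds suffice: the densities of all patterns of size `m` sum to `1`, and so do the
limits of the bounds, so `1` minus the bounds of the other patterns is an upper bound with the same
limit. -/
lemma tendsto_density_grid {n m : ℕ} (hn : 0 < n)
    {B : Matrix (Fin n) (Fin n) ℝ} (hB : ∀ a b, 0 ≤ B a b)
    (hsum : ∑ a, ∑ b, B a b = (n : ℝ) ^ 2)
    {τ : ∀ t, Equiv.Perm (Fin (Fintype.card (GridPoint (floorMatrix B t) t)))}
    {e : ∀ t, Fin (Fintype.card (GridPoint (floorMatrix B t) t)) ≃ GridPoint (floorMatrix B t) t}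
    (hτ : ∀ t, IsGridPerm _ t (τ t) (e t)) (σ : Equiv.Perm (Fin m)) :
    Tendsto (fun t => density ⟨m, σ⟩ ⟨_, τ t⟩) atTop (𝓝 (stepDensity B σ)) := by
  have hev : ∀ᶠ t : ℕ in atTop, 0 < t ∧ m ≤ Fintype.card (GridPoint (floorMatrix B t) t) :=
    (eventually_gt_atTop 0).and ((tendsto_card_gridPoint hn hB hsum).eventually_ge_atTop m)
  have hupper : Tendsto (fun t => 1 - ∑ σ' ∈ univ.erase σ, gridDensity B σ' t) atTop
      (𝓝 (stepDensity B σ)) := by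
    have h1 : stepDensity B σ = 1 - ∑ σ' ∈ univ.erase σ, stepDensity B σ' := by
      rw [← sum_stepDensity hn B hsum (m := m), ← Finset.add_sum_erase _ _ (mem_univ σ)]
      ring
    rw [h1]
    exact (tendsto_finsetSum _ fun σ' _ => tendsto_gridDensity hB σ').const_sub 1
  refine tendsto_of_tendsto_of_tendsto_of_le_of_le' (tendsto_gridDensity hB σ) hupper ?_ ?_
  · filter_upwards [hev] with t ht
    exact gridDensity_le_density hn ht.1 ht.2 hB hsum (hτ t) σ
  · filter_upwards [hev] with t ht
    have h1 := sum_density ht.2 (τ t)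
    rw [← Finset.add_sum_erase _ _ (mem_univ σ)] at h1
    have h2 : ∑ σ' ∈ univ.erase σ, gridDensity B σ' t ≤
        ∑ σ' ∈ univ.erase σ, density ⟨m, σ'⟩ ⟨_, τ t⟩ :=
      Finset.sum_le_sum fun σ' _ => gridDensity_le_density hn ht.1 ht.2 hB hsum (hτ t) σ'
    linarith

end FinPerm

/-! ### Discrepancy as a combination of six-point pattern counts. -/

lemma Fin.card_filter_le_lt {N a b : ℕ} (hb : b ≤ N) :
    (Finset.univ.filter fun i : Fin N => a ≤ (i : ℕ) ∧ (i : ℕ) < b).card = b - a := by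
  rw [← Nat.card_Ico, ← Finset.card_map Fin.valEmbedding]
  congr 1
  ext i
  simp only [Finset.mem_map, Finset.mem_filter, Finset.mem_univ, true_and, Fin.valEmbedding_apply,
    Finset.mem_Ico]
  exact ⟨fun ⟨j, hj, h⟩ => h ▸ hj, fun h => ⟨⟨i, h.2.trans_le hb⟩, h, rfl⟩⟩

namespace FinPerm

open Finset Filter Topology

/-- The number of points of `τ` among the first `x` positions and the first `y` values. -/
def cornerCount {N : ℕ} (τ : Equiv.Perm (Fin N)) (x y : ℕ) : ℕ :=
  #{i : Fin N | (i : ℕ) < x ∧ (τ i : ℕ) < y}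

/-- The scaled deviation of `cornerCount` from its value in a random permutation. -/
def discrepancy {N : ℕ} (τ : Equiv.Perm (Fin N)) (x y : ℕ) : ℝ :=
  N * cornerCount τ x y - x * y

/-- The sum of the squares of all discrepancies. -/
def discrepancySum {N : ℕ} (τ : Equiv.Perm (Fin N)) : ℝ :=
  ∑ x : Fin N, ∑ y : Fin N, discrepancy τ x y ^ 2

lemma cornerCount_mono {N : ℕ} (τ : Equiv.Perm (Fin N)) {x y x₀ y₀ : ℕ} (hx : x ≤ x₀)
    (hy : y ≤ y₀) : cornerCount τ x y ≤ cornerCount τ x₀ y₀ := by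
  refine Finset.card_le_card fun i hi => ?_
  simp only [mem_filter, mem_univ, true_and] at hi ⊢
  omega

lemma cornerCount_le_add {N : ℕ} (τ : Equiv.Perm (Fin N)) {x y x₀ y₀ : ℕ}
    (hx₀ : x₀ ≤ N) (hy₀ : y₀ ≤ N) :
    cornerCount τ x₀ y₀ ≤ cornerCount τ x y + (x₀ - x) + (y₀ - y) := by
  have h2 : #{i : Fin N | y ≤ (τ i : ℕ) ∧ (τ i : ℕ) < y₀} = y₀ - y := by
    rw [← Fin.card_filter_le_lt hy₀]
    refine Finset.card_bij' (fun a _ => τ a) (fun a _ => τ.symm a) ?_ ?_ ?_ ?_ <;> simp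
  rw [← Fin.card_filter_le_lt (a := x) hx₀, ← h2, cornerCount, cornerCount]
  refine (Finset.card_le_card ?_).trans
    ((Finset.card_union_le _ _).trans (Nat.add_le_add_right (Finset.card_union_le _ _) _))
  intro i hi
  simp only [mem_filter, mem_univ, true_and, mem_union] at hi ⊢
  omega

/-- Both terms of the discrepancy grow with the corner, each by at most `2 * s * N`, so their
difference changes by at most that much. -/
lemma abs_discrepancy_sub_le {N : ℕ} (τ : Equiv.Perm (Fin N)) {x y x₀ y₀ s : ℕ}
    (hx₀ : x₀ ≤ N) (hy₀ : y₀ ≤ N) (hx : x ≤ x₀) (hy : y ≤ y₀) (hxs : x₀ ≤ x + s)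
    (hys : y₀ ≤ y + s) : |discrepancy τ x₀ y₀ - discrepancy τ x y| ≤ 2 * s * N := by
  have h1 : (cornerCount τ x y : ℝ) ≤ cornerCount τ x₀ y₀ := by
    exact_mod_cast cornerCount_mono τ hx hy
  have h2 : (cornerCount τ x₀ y₀ : ℝ) ≤ cornerCount τ x y + 2 * s := by
    have := cornerCount_le_add τ (x := x) (y := y) hx₀ hy₀
    have : cornerCount τ x₀ y₀ ≤ cornerCount τ x y + 2 * s := by omega
    exact_mod_cast this
  have hx₀' : (x₀ : ℝ) ≤ N := by exact_mod_cast hx₀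
  have hy₀' : (y₀ : ℝ) ≤ N := by exact_mod_cast hy₀
  have hx' : (x : ℝ) ≤ x₀ := by exact_mod_cast hx
  have hy' : (y : ℝ) ≤ y₀ := by exact_mod_cast hy
  have hxs' : (x₀ : ℝ) ≤ x + s := by exact_mod_cast hxs
  have hys' : (y₀ : ℝ) ≤ y + s := by exact_mod_cast hys
  have h3 : (x : ℝ) * y ≤ x₀ * y₀ := by gcongr
  have h4 : (x₀ : ℝ) * y₀ - x * y ≤ 2 * s * N := by
    have e : (x₀ : ℝ) * y₀ - x * y = (x₀ - x) * y₀ + x * (y₀ - y) := by ring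
    have a1 : ((x₀ : ℝ) - x) * y₀ ≤ s * N := by
      apply mul_le_mul <;> linarith
    have a2 : (x : ℝ) * (y₀ - y) ≤ N * s := by
      apply mul_le_mul <;> linarith
    linarith
  have h5 : (N : ℝ) * cornerCount τ x₀ y₀ ≤ N * cornerCount τ x y + 2 * s * N := by
    have := mul_le_mul_of_nonneg_left h2 (Nat.cast_nonneg (α := ℝ) N)
    linarith
  have h6 : (N : ℝ) * cornerCount τ x y ≤ N * cornerCount τ x₀ y₀ := by gcongr
  unfold discrepancy
  rw [abs_le]
  constructor <;> linarith

/-- A large discrepancy at one place forces large discrepancies nearby. -/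
lemma le_discrepancySum {N : ℕ} (τ : Equiv.Perm (Fin N)) {x₀ y₀ s : ℕ}
    (hx₀ : x₀ ≤ N) (hy₀ : y₀ ≤ N) (hsx : s ≤ x₀) (hsy : s ≤ y₀)
    (hd : 4 * s * N ≤ |discrepancy τ x₀ y₀|) :
    4 * (s : ℝ) ^ 4 * (N : ℝ) ^ 2 ≤ discrepancySum τ := by
  -- The `s` coordinates just below `z`. Over `I x₀` and `I y₀` the discrepancy keeps absolute value
  -- at least `4sN - 2sN`.
  let I : ℕ → Finset (Fin N) := fun z =>
    univ.filter fun i : Fin N => z - s ≤ (i : ℕ) ∧ (i : ℕ) < z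
  have hcard : ∀ z : ℕ, z ≤ N → s ≤ z → #(I z) = s := by
    intro z hz hsz
    rw [Fin.card_filter_le_lt hz]; omega
  calc 4 * (s : ℝ) ^ 4 * (N : ℝ) ^ 2
      = ∑ x ∈ I x₀, ∑ y ∈ I y₀, (2 * s * N : ℝ) ^ 2 := by
        simp only [sum_const, hcard x₀ hx₀ hsx, hcard y₀ hy₀ hsy, nsmul_eq_mul]
        ring
    _ ≤ ∑ x ∈ I x₀, ∑ y ∈ I y₀, discrepancy τ x y ^ 2 := by
        refine Finset.sum_le_sum fun x hx => Finset.sum_le_sum fun y hy => ?_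
        simp only [I, mem_filter, mem_univ, true_and] at hx hy
        have h1 := abs_discrepancy_sub_le τ (x := x) (y := y) (s := s) hx₀ hy₀ hx.2.le hy.2.le
          (by omega) (by omega)
        have h2 := abs_sub_abs_le_abs_sub (discrepancy τ x₀ y₀) (discrepancy τ x y)
        rw [← sq_abs (discrepancy τ x y)]
        refine pow_le_pow_left₀ (by positivity) ?_ 2
        linarith
    _ ≤ discrepancySum τ := by
        refine (Finset.sum_le_sum fun x _ => Finset.sum_le_univ_sum_of_nonneg fun y =>
          sq_nonneg _).trans (Finset.sum_le_univ_sum_of_nonneg fun x =>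
            Finset.sum_nonneg fun y _ => sq_nonneg _)

/-- The indicator of `a < b`. -/
def ltInd {α : Type*} [LinearOrder α] (a b : α) : ℝ := if a < b then 1 else 0

/-- A statistic of the relative order of the positions of six points. -/
def posStat {α : Type*} [LinearOrder α] (v : Fin 6 → α) : ℝ :=
  ltInd (v 0) (v 4) * ltInd (v 2) (v 4)

/-- A statistic of the relative order of the values of six points. -/
def valStat {α : Type*} [LinearOrder α] (v : Fin 6 → α) : ℝ :=
  (ltInd (v 0) (v 5) - ltInd (v 1) (v 5)) * (ltInd (v 2) (v 5) - ltInd (v 3) (v 5))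

lemma posStat_congr {α β : Type*} [LinearOrder α] [LinearOrder β] {v : Fin 6 → α}
    {w : Fin 6 → β} (h : ∀ i j, v i < v j ↔ w i < w j) : posStat v = posStat w := by
  simp only [posStat, ltInd, h]

lemma valStat_congr {α β : Type*} [LinearOrder α] [LinearOrder β] {v : Fin 6 → α}
    {w : Fin 6 → β} (h : ∀ i j, v i < v j ↔ w i < w j) : valStat v = valStat w := by
  simp only [valStat, ltInd, h]

lemma abs_stat_le_one {α β : Type*} [LinearOrder α] [LinearOrder β] (v : Fin 6 → α)
    (w : Fin 6 → β) : |posStat v * valStat w| ≤ 1 := by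
  unfold posStat valStat ltInd
  split_ifs <;> norm_num

/-- Exchanging the points `0` and `1` reverses the sign. -/
lemma sum_valStat_perm : ∑ q : Equiv.Perm (Fin 6), valStat q = 0 := by
  have h : ∑ q : Equiv.Perm (Fin 6), valStat q = ∑ q : Equiv.Perm (Fin 6), -valStat q := by
    refine Fintype.sum_equiv (Equiv.mulRight (Equiv.swap 0 1)) _ _ fun q => ?_
    have h2 : (Equiv.swap (0 : Fin 6) 1) 2 = 2 := by decide
    have h3 : (Equiv.swap (0 : Fin 6) 1) 3 = 3 := by decide
    have h5 : (Equiv.swap (0 : Fin 6) 1) 5 = 5 := by decide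
    simp only [valStat, Equiv.coe_mulRight, Equiv.Perm.coe_mul, Function.comp_apply,
      Equiv.swap_apply_left, Equiv.swap_apply_right, h2, h3, h5]
    ring
  rw [Finset.sum_neg_distrib] at h
  linarith

/-- Six-tuples as triples of pairs. -/
def tripleOfPairsEquiv (α : Type*) : (α × α) × (α × α) × (α × α) ≃ (Fin 6 → α) where
  toFun q := ![q.1.1, q.1.2, q.2.1.1, q.2.1.2, q.2.2.1, q.2.2.2]
  invFun v := ((v 0, v 1), (v 2, v 3), (v 4, v 5))
  left_inv _ := rfl
  right_inv v := by ext i; fin_cases i <;> rfl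

/-- The auxiliary index `j` produces the factor `N` in the first term and `y` in the second, making
the discrepancy a sum of order indicators. -/
lemma sum_ltInd_eq_discrepancy {N : ℕ} (τ : Equiv.Perm (Fin N)) (x y : Fin N) :
    ∑ i, ∑ j, ltInd i x * (ltInd (τ i) y - ltInd (τ j) y) = discrepancy τ x y := by
  have h1 : ∀ z : Fin N, ∑ j, ltInd j z = (z : ℝ) := by
    intro z
    have := Fin.card_filter_le_lt (a := 0) z.2.le
    simp only [ltInd, sum_boole, Fin.lt_def]
    simpa using this
  have h2 : ∑ j, ltInd (τ j) y = (y : ℝ) := by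
    rw [← h1 y]
    exact Equiv.sum_comp τ fun j => ltInd j y
  have h3 : ∑ i, ltInd i x * ltInd (τ i) y = (cornerCount τ x y : ℝ) := by
    simp only [ltInd, ite_mul, one_mul, zero_mul, ← ite_and, sum_boole, cornerCount, Fin.lt_def]
  simp_rw [← Finset.mul_sum, Finset.sum_sub_distrib, h2, mul_sub, Finset.sum_sub_distrib,
    ← Finset.sum_mul, h1]
  simp only [sum_const, card_univ, Fintype.card_fin, nsmul_eq_mul, discrepancy]
  rw [← h3, Finset.mul_sum]
  congr 1
  refine Finset.sum_congr rfl fun i _ => by ring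

/-- The points `0, 1` and `2, 3` carry two copies of the discrepancy; the position of point `4` and
the value of point `5` mark the corner. To this end the height of the corner is reindexed as `τ y`.
-/
lemma discrepancySum_eq {N : ℕ} (τ : Equiv.Perm (Fin N)) :
    discrepancySum τ = ∑ φ : Fin 6 → Fin N, posStat φ * valStat (τ ∘ φ) := by
  rw [← Equiv.sum_comp (tripleOfPairsEquiv (Fin N))]
  have h : ∀ q, posStat (tripleOfPairsEquiv (Fin N) q) *
      valStat (τ ∘ tripleOfPairsEquiv (Fin N) q) =
      (ltInd q.1.1 q.2.2.1 * (ltInd (τ q.1.1) (τ q.2.2.2) - ltInd (τ q.1.2) (τ q.2.2.2))) *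
      (ltInd q.2.1.1 q.2.2.1 * (ltInd (τ q.2.1.1) (τ q.2.2.2) - ltInd (τ q.2.1.2) (τ q.2.2.2))) := by
    intro q
    change ltInd q.1.1 q.2.2.1 * ltInd q.2.1.1 q.2.2.1 *
      ((ltInd (τ q.1.1) (τ q.2.2.2) - ltInd (τ q.1.2) (τ q.2.2.2)) *
        (ltInd (τ q.2.1.1) (τ q.2.2.2) - ltInd (τ q.2.1.2) (τ q.2.2.2))) = _
    ring
  simp_rw [h]
  simp only [Fintype.sum_prod_type]
  have hsq : ∀ x y : Fin N, discrepancy τ x (τ y) ^ 2 =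
      ∑ i, ∑ j, ∑ i', ∑ j', (ltInd i x * (ltInd (τ i) (τ y) - ltInd (τ j) (τ y))) *
        (ltInd i' x * (ltInd (τ i') (τ y) - ltInd (τ j') (τ y))) := by
    intro x y
    rw [sq, ← sum_ltInd_eq_discrepancy]
    simp_rw [Finset.sum_mul, Finset.mul_sum]
  have hT : discrepancySum τ = ∑ x : Fin N, ∑ y : Fin N, discrepancy τ x (τ y) ^ 2 := by
    unfold discrepancySum
    refine Finset.sum_congr rfl fun x _ => ?_
    exact (Equiv.sum_comp τ fun y => discrepancy τ x y ^ 2).symm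
  rw [hT]
  simp_rw [hsq]
  simp only [← Fintype.sum_prod_type']
  refine Fintype.sum_equiv ⟨fun q => (q.2.2.1, q.2.2.2.1, q.2.2.2.2.1, q.2.2.2.2.2, q.1, q.2.1),
    fun q => (q.2.2.2.2.1, q.2.2.2.2.2, q.1, q.2.1, q.2.2.1, q.2.2.2.1), fun _ => rfl,
    fun _ => rfl⟩ _ _ fun q => rfl

/-- An injective map is uniquely an increasing map composed with a permutation. -/
lemma sum_injective_eq {m N : ℕ} (F : (Fin m → Fin N) → ℝ) :
    ∑ φ with Function.Injective φ, F φ =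
      ∑ φ with StrictMono φ, ∑ p : Equiv.Perm (Fin m), F (φ ∘ p) := by
  rw [← Finset.sum_product']
  symm
  refine Finset.sum_nbij (fun q => q.1 ∘ q.2) ?_ ?_ ?_ (fun _ _ => rfl)
  · intro q hq
    have : StrictMono q.1 := by simpa using hq
    simpa using this.injective
  · intro q hq q' hq' h
    have h1 : StrictMono q.1 := by simpa using hq
    have h2 : StrictMono q'.1 := by simpa using hq'
    have h : q.1 ∘ q.2 = q'.1 ∘ q'.2 := h
    have e : q.1 = q'.1 := by
      refine (h1.range_inj h2).1 ?_
      rw [← q.2.surjective.range_comp q.1, h, q'.2.surjective.range_comp]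
    refine Prod.ext e (Equiv.ext fun i => h1.injective ?_)
    have := congrFun h i
    simpa [e] using this
  · intro φ hφ
    have hφ : Function.Injective φ := by simpa using hφ
    refine ⟨(φ ∘ Tuple.sort φ, (Tuple.sort φ)⁻¹), ?_, by ext; simp⟩
    simpa using (Tuple.monotone_sort φ).strictMono_of_injective
      (hφ.comp (Tuple.sort φ).injective)

/-- The total value of the six-point statistic on an occurrence of the pattern `σ`. -/
def patternStat (σ : Equiv.Perm (Fin 6)) : ℝ :=
  ∑ p : Equiv.Perm (Fin 6), posStat p * valStat (σ ∘ p)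

lemma sum_patternStat : ∑ σ, patternStat σ = 0 := by
  unfold patternStat
  rw [Finset.sum_comm]
  refine Finset.sum_eq_zero fun p _ => ?_
  rw [← Finset.mul_sum]
  have : ∑ σ : Equiv.Perm (Fin 6), valStat (σ ∘ p) = ∑ q : Equiv.Perm (Fin 6), valStat q :=
    Fintype.sum_equiv (Equiv.mulRight p) _ _ fun σ => rfl
  rw [this, sum_valStat_perm, mul_zero]

lemma sum_injective_stat {N : ℕ} (τ : Equiv.Perm (Fin N)) :
    ∑ φ : Fin 6 → Fin N with Function.Injective φ, posStat φ * valStat (τ ∘ φ) =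
      ∑ σ : Equiv.Perm (Fin 6), (#(occurrences σ τ) : ℝ) * patternStat σ := by
  rw [sum_injective_eq]
  have h := sum_card_filter_occurrences τ (fun (σ : Equiv.Perm (Fin 6)) _ => patternStat σ)
  simp only [sum_const, nsmul_eq_mul] at h
  rw [h]
  refine Finset.sum_congr rfl fun φ hφ => ?_
  have hφ : StrictMono φ := by simpa using hφ
  obtain ⟨σ, hσ, hu⟩ := exists_filter_mem_occurrences τ hφ
  rw [hu, Finset.sum_singleton]
  refine Finset.sum_congr rfl fun p _ => ?_
  congr 1
  · exact posStat_congr fun i j => hφ.lt_iff_lt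
  · exact valStat_congr fun i j => ((mem_occurrences.1 hσ).2 (p i) (p j)).symm

/-- Only non-injective six-tuples are lost, and each contributes at most `1` in absolute value. -/
lemma abs_discrepancySum_sub_le {N : ℕ} (τ : Equiv.Perm (Fin N)) :
    |discrepancySum τ - ∑ σ : Equiv.Perm (Fin 6), (#(occurrences σ τ) : ℝ) * patternStat σ| ≤
      (N : ℝ) ^ 6 - N.descFactorial 6 := by
  have hcard : (#{φ : Fin 6 → Fin N | Function.Injective φ} : ℝ) = N.descFactorial 6 := by
    rw [← Fintype.card_subtype, Fintype.card_congr (Equiv.subtypeInjectiveEquivEmbedding _ _),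
      Fintype.card_embedding_eq]
    simp
  have htot : (#{φ : Fin 6 → Fin N | Function.Injective φ} : ℝ) +
      #{φ : Fin 6 → Fin N | ¬ Function.Injective φ} = (N : ℝ) ^ 6 := by
    rw [← Nat.cast_add, Finset.card_filter_add_card_filter_not]
    simp
  rw [discrepancySum_eq, ← sum_injective_stat, ← Finset.sum_filter_add_sum_filter_not univ
    (fun φ : Fin 6 → Fin N => Function.Injective φ), add_sub_cancel_left]
  calc _ ≤ ∑ φ : Fin 6 → Fin N with ¬ Function.Injective φ, |posStat φ * valStat (τ ∘ φ)| :=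
        Finset.abs_sum_le_sum_abs _ _
    _ ≤ ∑ φ : Fin 6 → Fin N with ¬ Function.Injective φ, 1 :=
        Finset.sum_le_sum fun φ _ => abs_stat_le_one _ _
    _ = (N : ℝ) ^ 6 - N.descFactorial 6 := by
        rw [Finset.sum_const, nsmul_eq_mul, mul_one]
        linarith

/-- Quasirandom sequences have small discrepancies. -/
lemma IsQuasirandom.tendsto_discrepancySum {X : ℕ → FinPerm} (hX : IsQuasirandom X)
    (hsize : Tendsto (fun t => (X t).size) atTop atTop) :
    Tendsto (fun t => discrepancySum (X t).2 / ((X t).size : ℝ) ^ 6) atTop (𝓝 0) := by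
  have hdf : Tendsto (fun t => ((X t).size.descFactorial 6 : ℝ) / ((X t).size : ℝ) ^ 6) atTop
      (𝓝 1) := (tendsto_descFactorial_div_pow 6).comp hsize
  have hmain : Tendsto (fun t => (∑ σ : Equiv.Perm (Fin 6),
      (#(occurrences σ (X t).2) : ℝ) * patternStat σ) / ((X t).size : ℝ) ^ 6) atTop (𝓝 0) := by
    -- In the limit all patterns of size 6 have the same weight `1 / 720`, and `patternStat` sums to
    -- zero.
    have h1 : Tendsto (fun t => ((X t).size.descFactorial 6 : ℝ) / ((X t).size : ℝ) ^ 6 / 720 *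
        ∑ σ : Equiv.Perm (Fin 6), density ⟨6, σ⟩ (X t) * patternStat σ) atTop
        (𝓝 (1 / 720 * ∑ σ : Equiv.Perm (Fin 6), 1 / 720 * patternStat σ)) := by
      refine (hdf.div_const _).mul (tendsto_finsetSum _ fun σ _ => ?_)
      have := (hX ⟨6, σ⟩).mul_const (patternStat σ)
      simpa [size, Nat.factorial] using this
    rw [← Finset.mul_sum, sum_patternStat, mul_zero, mul_zero] at h1
    refine h1.congr' ?_
    filter_upwards [hsize.eventually_ge_atTop 6] with t ht
    have hd : ∀ σ : Equiv.Perm (Fin 6), density ⟨6, σ⟩ (X t) =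
        #(occurrences σ (X t).2) / ((X t).size.choose 6 : ℝ) :=
      fun σ => density_eq_card_occurrences ht σ (X t).2
    have hc : (((X t).size.choose 6 : ℕ) : ℝ) ≠ 0 := by
      exact_mod_cast (Nat.choose_pos ht).ne'
    simp_rw [hd, div_mul_eq_mul_div, ← Finset.sum_div]
    rw [Nat.descFactorial_eq_factorial_mul_choose]
    push_cast
    have : ((Nat.factorial 6 : ℕ) : ℝ) = 720 := by norm_num [Nat.factorial]
    rw [this]
    field_simp
  have herr : Tendsto (fun t => (discrepancySum (X t).2 - ∑ σ : Equiv.Perm (Fin 6),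
      (#(occurrences σ (X t).2) : ℝ) * patternStat σ) / ((X t).size : ℝ) ^ 6) atTop (𝓝 0) := by
    have h0 := hdf.const_sub 1
    rw [sub_self] at h0
    refine squeeze_zero_norm' ?_ h0
    filter_upwards [hsize.eventually_gt_atTop 0] with t ht
    have hN : (0 : ℝ) < (X t).size := by exact_mod_cast ht
    rw [Real.norm_eq_abs, abs_div, abs_of_pos (pow_pos hN 6), div_le_iff₀ (by positivity)]
    refine (abs_discrepancySum_sub_le (X t).2).trans (le_of_eq ?_)
    field_simp
  have := herr.add hmain
  rw [add_zero] at this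
  refine this.congr fun t => ?_
  rw [← add_div, sub_add_cancel]

/-! ### Corners of grid permutations. -/

lemma card_filter_gridPoint {n t : ℕ} (N : Matrix (Fin n) (Fin n) ℕ) (Q : Fin n → Fin n → Prop)
    [∀ a b, Decidable (Q a b)] :
    #{p : GridPoint N t | Q p.1.1.1 p.1.2.1} = t ^ 2 * ∑ a, ∑ b, if Q a b then N a b else 0 := by
  rw [Finset.card_filter, Fintype.sum_sigma]
  have h : ∀ z : (Fin n × Fin t) × (Fin n × Fin t), (∑ _p : Fin (N z.1.1 z.2.1),
      if Q z.1.1 z.2.1 then 1 else 0) = if Q z.1.1 z.2.1 then N z.1.1 z.2.1 else 0 := by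
    intro z; split_ifs <;> simp
  refine (Finset.sum_congr rfl fun z _ => h z).trans ?_
  simp only [Fintype.sum_prod_type, Finset.sum_const, Finset.card_univ, Fintype.card_fin,
    smul_eq_mul, ← Finset.mul_sum]
  ring

section Grid

variable {n t M : ℕ} {N : Matrix (Fin n) (Fin n) ℕ} {τ : Equiv.Perm (Fin M)}
  {e : Fin M ≃ GridPoint N t}

/-- Positions are sorted by block row, so the points in block rows up to `J` fill an initial
segment. -/
lemma IsGridPerm.lt_iff_row_le (hτ : IsGridPerm N t τ e) (J : Fin n) (i : Fin M) :
    (i : ℕ) < #{p : GridPoint N t | p.1.1.1 ≤ J} ↔ (e i).1.1.1 ≤ J := by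
  have hmono : Monotone fun i => (e i).1.1.1 := by
    intro i j hij
    by_contra! h
    exact absurd (hτ.lt_of_row_lt j i (Prod.Lex.toLex_lt_toLex.2 (Or.inl h))) (not_lt.2 hij)
  rw [← Tuple.lt_card_le_iff_apply_le_of_monotone hmono]
  have : #{p : GridPoint N t | p.1.1.1 ≤ J} = #{i : Fin M | (e i).1.1.1 ≤ J} :=
    Finset.card_bij' (fun p _ => e.symm p) (fun i _ => e i) (by simp) (by simp) (by simp)
      (by simp)
  rw [this]

lemma IsGridPerm.lt_iff_col_le (hτ : IsGridPerm N t τ e) (J : Fin n) (i : Fin M) :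
    (τ i : ℕ) < #{p : GridPoint N t | p.1.2.1 ≤ J} ↔ (e i).1.2.1 ≤ J := by
  have hmono : Monotone fun i => (e (τ.symm i)).1.2.1 := by
    intro i j hij
    by_contra! h
    have := hτ.lt_of_col_lt (τ.symm j) (τ.symm i) (Prod.Lex.toLex_lt_toLex.2 (Or.inl h))
    simp only [Equiv.apply_symm_apply] at this
    exact absurd this (not_lt.2 hij)
  have h1 := Tuple.lt_card_le_iff_apply_le_of_monotone (j := τ i) (a := J) hmono
  simp only [Equiv.symm_apply_apply] at h1
  rw [← h1]
  have : #{p : GridPoint N t | p.1.2.1 ≤ J} = #{i : Fin M | (e (τ.symm i)).1.2.1 ≤ J} :=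
    Finset.card_bij' (fun p _ => τ (e.symm p)) (fun i _ => e (τ.symm i)) (by simp) (by simp)
      (by simp) (by simp)
  rw [this]

lemma IsGridPerm.cornerCount_eq (hτ : IsGridPerm N t τ e) (J J' : Fin n) :
    cornerCount τ #{p : GridPoint N t | p.1.1.1 ≤ J} #{p : GridPoint N t | p.1.2.1 ≤ J'} =
      #{p : GridPoint N t | p.1.1.1 ≤ J ∧ p.1.2.1 ≤ J'} := by
  unfold cornerCount
  simp only [hτ.lt_iff_row_le, hτ.lt_iff_col_le]
  exact Finset.card_bij' (fun i _ => e i) (fun p _ => e.symm p) (by simp) (by simp) (by simp)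
    (by simp)

end Grid

lemma tendsto_card_filter_gridPoint {n : ℕ} {B : Matrix (Fin n) (Fin n) ℝ}
    (hB : ∀ a b, 0 ≤ B a b) (Q : Fin n → Fin n → Prop) [∀ a b, Decidable (Q a b)] :
    Tendsto (fun t : ℕ => (#{p : GridPoint (floorMatrix B t) t | Q p.1.1.1 p.1.2.1} : ℝ) /
      (t : ℝ) ^ 3) atTop (𝓝 (∑ a, ∑ b, if Q a b then B a b else 0)) := by
  have h : Tendsto (fun t : ℕ => ∑ a, ∑ b,
      if Q a b then (floorMatrix B t a b : ℝ) / t else 0) atTop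
      (𝓝 (∑ a, ∑ b, if Q a b then B a b else 0)) := by
    refine tendsto_finsetSum _ fun a _ => tendsto_finsetSum _ fun b _ => ?_
    split_ifs
    · exact tendsto_floorMatrix_div hB a b
    · exact tendsto_const_nhds
  refine h.congr' ?_
  filter_upwards [eventually_gt_atTop 0] with t ht
  have ht' : (t : ℝ) ≠ 0 := by positivity
  rw [card_filter_gridPoint]
  push_cast
  have : ∀ a b, (if Q a b then (floorMatrix B t a b : ℝ) / t else 0) =
      (if Q a b then (floorMatrix B t a b : ℝ) else 0) / t := by
    intro a b; split_ifs <;> simp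
  simp_rw [this, ← Finset.sum_div]
  field_simp

/-- If the mass of a corner of the matrix `B` is not the product of the masses of the
corresponding rows and columns, then the grid permutations of `B` are not quasirandom. -/
lemma not_isQuasirandom_grid {n : ℕ} (hn : 0 < n) {B : Matrix (Fin n) (Fin n) ℝ}
    (hB : ∀ a b, 0 ≤ B a b) (hsum : ∑ a, ∑ b, B a b = (n : ℝ) ^ 2)
    {τ : ∀ t, Equiv.Perm (Fin (Fintype.card (GridPoint (floorMatrix B t) t)))}
    {e : ∀ t, Fin (Fintype.card (GridPoint (floorMatrix B t) t)) ≃ GridPoint (floorMatrix B t) t}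
    (hτ : ∀ t, IsGridPerm _ t (τ t) (e t)) {J J' : Fin n} {R C S : ℝ}
    (hR : ∑ a, ∑ b, (if a ≤ J then B a b else 0) = R)
    (hC : ∑ a, ∑ b, (if b ≤ J' then B a b else 0) = C)
    (hS : ∑ a, ∑ b, (if a ≤ J ∧ b ≤ J' then B a b else 0) = S)
    (hR0 : 0 < R) (hC0 : 0 < C) (hne : (n : ℝ) ^ 2 * S - R * C ≠ 0) :
    ¬ IsQuasirandom fun t => ⟨_, τ t⟩ := by
  intro hX
  have hT := hX.tendsto_discrepancySum (tendsto_card_gridPoint hn hB hsum)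
  set M : ℕ → ℕ := fun t => Fintype.card (GridPoint (floorMatrix B t) t)
  set x₀ : ℕ → ℕ := fun t => #{p : GridPoint (floorMatrix B t) t | p.1.1.1 ≤ J}
  set y₀ : ℕ → ℕ := fun t => #{p : GridPoint (floorMatrix B t) t | p.1.2.1 ≤ J'}
  set c : ℕ → ℕ := fun t => #{p : GridPoint (floorMatrix B t) t | p.1.1.1 ≤ J ∧ p.1.2.1 ≤ J'}
  have hM : Tendsto (fun t => (M t : ℝ) / (t : ℝ) ^ 3) atTop (𝓝 ((n : ℝ) ^ 2)) :=
    tendsto_card_gridPoint_div hB hsum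
  have hx : Tendsto (fun t => (x₀ t : ℝ) / (t : ℝ) ^ 3) atTop (𝓝 R) :=
    hR ▸ tendsto_card_filter_gridPoint hB fun a _ => a ≤ J
  have hy : Tendsto (fun t => (y₀ t : ℝ) / (t : ℝ) ^ 3) atTop (𝓝 C) :=
    hC ▸ tendsto_card_filter_gridPoint hB fun _ b => b ≤ J'
  have hc : Tendsto (fun t => (c t : ℝ) / (t : ℝ) ^ 3) atTop (𝓝 S) :=
    hS ▸ tendsto_card_filter_gridPoint hB fun a b => a ≤ J ∧ b ≤ J'
  have hdisc : Tendsto (fun t => |discrepancy (τ t) (x₀ t) (y₀ t)| / (t : ℝ) ^ 6) atTop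
      (𝓝 |(n : ℝ) ^ 2 * S - R * C|) := by
    refine ((hM.mul hc).sub (hx.mul hy)).abs.congr fun t => ?_
    have h1 : cornerCount (τ t) (x₀ t) (y₀ t) = c t := (hτ t).cornerCount_eq J J'
    have h2 : (0 : ℝ) ≤ (t : ℝ) ^ 6 := by positivity
    rw [← abs_of_nonneg h2, ← abs_div, discrepancy, h1]
    congr 1
    change (M t : ℝ) / (t : ℝ) ^ 3 * (c t / (t : ℝ) ^ 3) -
      x₀ t / (t : ℝ) ^ 3 * (y₀ t / (t : ℝ) ^ 3) = ((M t : ℝ) * c t - x₀ t * y₀ t) / (t : ℝ) ^ 6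
    rw [div_mul_div_comm, div_mul_div_comm, ← sub_div, ← pow_add]
  have hn2 : (0 : ℝ) < (n : ℝ) ^ 2 := by positivity
  set L := |(n : ℝ) ^ 2 * S - R * C|
  have hL : 0 < L := abs_pos.2 hne
  -- With `s ≈ δ t³`, the first two bounds make the `s × s` square fit inside the corner, and the
  -- third keeps `4sM ≈ 4δn²t⁶` below the discrepancy, which is about `L t⁶`.
  obtain ⟨δ, hδ, hδR, hδC, hδL⟩ : ∃ δ : ℝ, 0 < δ ∧ δ < R ∧ δ < C ∧ 4 * δ * (n : ℝ) ^ 2 < L := by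
    refine ⟨min (min (R / 2) (C / 2)) (L / (8 * (n : ℝ) ^ 2)), by positivity, ?_, ?_, ?_⟩
    · exact lt_of_le_of_lt ((min_le_left _ _).trans (min_le_left _ _)) (by linarith)
    · exact lt_of_le_of_lt ((min_le_left _ _).trans (min_le_right _ _)) (by linarith)
    · have := min_le_right (min (R / 2) (C / 2)) (L / (8 * (n : ℝ) ^ 2))
      rw [le_div_iff₀ (by positivity)] at this
      nlinarith
  set s : ℕ → ℕ := fun t => ⌊δ * ((t ^ 3 : ℕ) : ℝ)⌋₊
  have ht3 : Tendsto (fun t : ℕ => t ^ 3) atTop atTop := tendsto_pow_atTop (by norm_num)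
  have hs : Tendsto (fun t => (s t : ℝ) / (t : ℝ) ^ 3) atTop (𝓝 δ) := by
    have := ((tendsto_nat_floor_mul_div_atTop hδ.le).comp tendsto_natCast_atTop_atTop).comp ht3
    refine this.congr fun t => ?_
    simp [s]
  -- This is `4 s⁴ M² / M⁶ = 4 (s / M)⁴`, whose limit is positive.
  have hlow : ∀ᶠ t in atTop, 4 * ((s t : ℝ) / (t : ℝ) ^ 3) ^ 4 / ((M t : ℝ) / (t : ℝ) ^ 3) ^ 4 ≤
      discrepancySum (τ t) / (M t : ℝ) ^ 6 := by
    have h4 := ((hs.const_mul 4).mul hM)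
    filter_upwards [hs.eventually_lt hx hδR, hs.eventually_lt hy hδC, h4.eventually_lt hdisc hδL,
      eventually_gt_atTop 0, (tendsto_card_gridPoint hn hB hsum).eventually_gt_atTop 0]
      with t h1 h2 h3 ht hMt
    have ht' : (0 : ℝ) < t := by exact_mod_cast ht
    have hMt' : (0 : ℝ) < M t := by exact_mod_cast hMt
    have k1 : s t ≤ x₀ t := by
      rw [div_lt_div_iff_of_pos_right (by positivity)] at h1
      exact_mod_cast h1.le
    have k2 : s t ≤ y₀ t := by
      rw [div_lt_div_iff_of_pos_right (by positivity)] at h2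
      exact_mod_cast h2.le
    have k3 : 4 * (s t : ℝ) * M t ≤ |discrepancy (τ t) (x₀ t) (y₀ t)| := by
      rw [lt_div_iff₀ (by positivity)] at h3
      refine le_trans (le_of_eq ?_) h3.le
      field_simp
    have k4 := le_discrepancySum (τ t) (Finset.card_le_univ _) (Finset.card_le_univ _) k1 k2 k3
    rw [le_div_iff₀ (by positivity)]
    refine le_trans (le_of_eq ?_) k4
    field_simp
    rfl
  have hlim : Tendsto (fun t => 4 * ((s t : ℝ) / (t : ℝ) ^ 3) ^ 4 /
      ((M t : ℝ) / (t : ℝ) ^ 3) ^ 4) atTop (𝓝 (4 * δ ^ 4 / ((n : ℝ) ^ 2) ^ 4)) :=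
    ((hs.pow 4).const_mul 4).div (hM.pow 4) (by positivity)
  have := le_of_tendsto_of_tendsto hlim hT hlow
  have hpos : 0 < 4 * δ ^ 4 / ((n : ℝ) ^ 2) ^ 4 := by positivity
  linarith

end FinPerm

/-! ### Common zeros near a degenerate point. -/

section Analysis

open Filter Topology Asymptotics

variable {E : Type*} [NormedAddCommGroup E] [NormedSpace ℝ E]

/-- The second-order Taylor formula at a critical point. -/
lemma ContDiff.isLittleO_sub_half_fderiv_fderiv {F : E → ℝ} (hF : ContDiff ℝ 2 F) (hF0 : F 0 = 0)
    (hdF : fderiv ℝ F 0 = 0) :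
    (fun y => F y - (1 / 2) * fderiv ℝ (fderiv ℝ F) 0 y y) =o[𝓝 0] fun y => ‖y‖ ^ 2 := by
  set A := fderiv ℝ (fderiv ℝ F) 0
  -- Symmetry merges the two terms in the derivative of `A y y` into `2 A y`.
  have hsymm : ∀ v w, A v w = A w v := by
    have : IsSymmSndFDerivAt ℝ F 0 := hF.contDiffAt.isSymmSndFDerivAt (by simp)
    exact fun v w => this v w
  have hd : ∀ y, HasFDerivAt (fun y => F y - (1 / 2) * A y y) (fderiv ℝ F y - A y) y := by
    intro y
    have h1 : HasFDerivAt F (fderiv ℝ F y) y :=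
      (hF.differentiable (by norm_num)).differentiableAt.hasFDerivAt
    have h2 : HasFDerivAt (fun y => A y y) (A y + A.flip y) y := by
      have := (A.hasFDerivAt (x := y)).clm_apply (hasFDerivAt_id y)
      simpa using this
    convert! h1.sub (h2.const_mul (1 / 2)) using 2
    ext w
    simp only [_root_.add_apply, _root_.smul_apply,
      ContinuousLinearMap.flip_apply, smul_eq_mul, hsymm w y]
    ring
  -- The derivative of the remainder is `o(‖y‖)`; integrating along segments gains one power.
  have hlo : (fun y => fderiv ℝ F y - A y) =o[𝓝 0] fun y => ‖y - 0‖ ^ 1 := by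
    have hdiff : DifferentiableAt ℝ (fderiv ℝ F) 0 :=
      ((hF.fderiv_right (m := 1) (by norm_num)).differentiable (by norm_num)).differentiableAt
    have := hdiff.hasFDerivAt.isLittleO
    simp only [hdF, sub_zero] at this
    simpa using this.norm_right
  have := convex_univ.isLittleO_pow_succ (n := 1) (x₀ := (0 : E)) (Set.mem_univ 0)
    (fun y _ => (hd y).hasFDerivWithinAt) (by rwa [nhdsWithin_univ])
  simpa [hF0] using this

/-- The second-order behaviour at a critical point along a curve depends only on its velocity. -/
lemma ContDiff.tendsto_comp_div_sq {F : E → ℝ} (hF : ContDiff ℝ 2 F) (hF0 : F 0 = 0)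
    (hdF : fderiv ℝ F 0 = 0) {c : ℝ → E} {u : E} (hc0 : c 0 = 0) (hc : HasDerivAt c u 0) :
    Tendsto (fun s => F (c s) / s ^ 2) (𝓝[>] 0)
      (𝓝 ((1 / 2) * fderiv ℝ (fderiv ℝ F) 0 u u)) := by
  set A := fderiv ℝ (fderiv ℝ F) 0
  have hslope : Tendsto (fun s : ℝ => s⁻¹ • c s) (𝓝[>] 0) (𝓝 u) := by
    have := hc.tendsto_slope_zero_right
    simpa [hc0] using this
  have hcz : Tendsto c (𝓝[>] 0) (𝓝 0) := by
    have := hc.continuousAt.tendsto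
    rw [hc0] at this
    exact this.mono_left nhdsWithin_le_nhds
  have hbig : c =O[𝓝[>] 0] fun s : ℝ => s := by
    have := hc.hasFDerivAt.isBigO_sub
    simp only [hc0, sub_zero] at this
    exact this.mono nhdsWithin_le_nhds
  have herr : (fun s => F (c s) - (1 / 2) * A (c s) (c s)) =o[𝓝[>] 0] fun s : ℝ => s ^ 2 :=
    ((hF.isLittleO_sub_half_fderiv_fderiv hF0 hdF).comp_tendsto hcz).trans_isBigO
      (hbig.norm_left.pow 2)
  have hquad : Tendsto (fun s : ℝ => (1 / 2) * A (s⁻¹ • c s) (s⁻¹ • c s)) (𝓝[>] 0)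
      (𝓝 ((1 / 2) * A u u)) := by
    have hcont : Continuous fun y => (1 / 2 : ℝ) * A y y := by fun_prop
    exact (hcont.tendsto u).comp hslope
  have := herr.tendsto_div_nhds_zero.add hquad
  rw [zero_add] at this
  refine this.congr' ?_
  filter_upwards [self_mem_nhdsWithin] with s hs
  have hs : s ≠ 0 := ne_of_gt hs
  simp only [map_smul, _root_.smul_apply, smul_eq_mul]
  field_simp
  ring

/-- If `F` has a critical point at `0` at which its second derivative takes values of both signs
on the kernel of the derivative of the submersion `G`, then `F` and `G` have common zeros other
than `0` in every neighbourhood of `0`. -/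
lemma exists_ne_zero_common_zero [CompleteSpace E] {ι : Type*} [Fintype ι] {G : E → ι → ℝ}
    {G' : E →L[ℝ] (ι → ℝ)} (hG : HasStrictFDerivAt G G' 0) (hsurj : G'.range = ⊤) (hG0 : G 0 = 0)
    {F : E → ℝ} (hF : ContDiff ℝ 2 F) (hF0 : F 0 = 0) (hdF : fderiv ℝ F 0 = 0)
    {u v : E} (hu : G' u = 0) (hv : G' v = 0) (hupos : 0 < fderiv ℝ (fderiv ℝ F) 0 u u)
    (hvneg : fderiv ℝ (fderiv ℝ F) 0 v v < 0) {U : Set E} (hU : U ∈ 𝓝 0) :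
    ∃ x ∈ U, x ≠ 0 ∧ G x = 0 ∧ F x = 0 := by
  set A := fderiv ℝ (fderiv ℝ F) 0
  -- A parametrisation of the zero set of `G` by the tangent space, whose derivative at `0` is the
  -- inclusion.
  set φ : G'.ker → E := hG.implicitFunction G G' hsurj (G 0)
  have hφ : HasStrictFDerivAt φ G'.ker.subtypeL 0 := hG.to_implicitFunction hsurj
  have hφ0 : φ 0 = 0 := hG.implicitFunction_apply_image hsurj
  have hGφ : ∀ᶠ w in 𝓝 (0 : G'.ker), G (φ w) = 0 := by
    have h1 := hG.map_implicitFunction_eq hsurj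
    have h2 : Tendsto (fun w : G'.ker => (G 0, w)) (𝓝 0) (𝓝 (G 0, 0)) :=
      (Continuous.prodMk_right (G 0)).tendsto 0
    filter_upwards [h2.eventually h1] with w hw
    rw [hG0] at hw
    simpa [φ, hG0] using hw
  have hφU : ∀ᶠ w in 𝓝 (0 : G'.ker), φ w ∈ U := by
    have := hφ.hasFDerivAt.continuousAt
    exact this.eventually (by rwa [hφ0])
  have hφne : ∀ᶠ w in 𝓝 (0 : G'.ker), φ w = 0 → w = 0 := by
    have h1 := hφ.hasFDerivAt.isLittleO.def (c := 1 / 2) (by norm_num)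
    filter_upwards [h1] with w hw h
    rw [h, hφ0] at hw
    simp only [sub_zero, zero_sub, norm_neg, Submodule.subtypeL_apply] at hw
    have : ‖w‖ ≤ 1 / 2 * ‖w‖ := hw
    exact norm_le_zero_iff.1 (by linarith [norm_nonneg w])
  -- Strict differentiability makes `φ` Lipschitz, hence continuous, near `0`, as the intermediate
  -- value argument needs.
  obtain ⟨K, S, hS, hlip⟩ := hφ.exists_lipschitzOnWith
  obtain ⟨r, hr, hball⟩ := Metric.mem_nhds_iff.1 (hGφ.and (hφU.and (hφne.and hS)))
  have hcurve : ∀ w : G'.ker, Tendsto (fun s : ℝ => F (φ (s • w)) / s ^ 2) (𝓝[>] 0)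
      (𝓝 ((1 / 2) * A w w)) := by
    intro w
    refine hF.tendsto_comp_div_sq hF0 hdF (c := fun s => φ (s • w)) (by simp [hφ0]) ?_
    have h1 : HasDerivAt (fun s : ℝ => s • w) w 0 := by
      simpa using (hasDerivAt_id (0 : ℝ)).smul_const w
    have h2 : HasFDerivAt φ G'.ker.subtypeL ((0 : ℝ) • w) := by
      rw [zero_smul]; exact hφ.hasFDerivAt
    exact h2.comp_hasDerivAt 0 h1
  have hsmall : ∀ w : G'.ker, ∀ᶠ s : ℝ in 𝓝[>] 0, s • w ∈ Metric.ball (0 : G'.ker) r := by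
    intro w
    have : Tendsto (fun s : ℝ => s • w) (𝓝 0) (𝓝 0) := by
      have : Continuous fun s : ℝ => s • w := by fun_prop
      simpa using this.tendsto 0
    exact (this.mono_left nhdsWithin_le_nhds).eventually (Metric.ball_mem_nhds 0 hr)
  set u' : G'.ker := ⟨u, hu⟩
  set v' : G'.ker := ⟨v, hv⟩
  obtain ⟨s, hsu, hsv, hFu, hFv, hs⟩ := ((hsmall u').and ((hsmall v').and
    (((hcurve u').eventually_const_lt (u := 0) (by change 0 < 1 / 2 * A u u; linarith)).and
    (((hcurve v').eventually_lt_const (u := 0) (by change 1 / 2 * A v v < 0; linarith)).and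
      self_mem_nhdsWithin)))).exists
  have hs : 0 < s := hs
  have hFu : 0 < F (φ (s • u')) := (div_pos_iff_of_pos_right (by positivity)).1 hFu
  have hFv : F (φ (s • v')) < 0 := (div_neg_iff.1 hFv).elim
    (fun h => absurd h.2 (by have : 0 < s ^ 2 := by positivity
                             linarith)) fun h => h.1
  have hsub : segment ℝ (s • u') (s • v') ⊆ Metric.ball 0 r :=
    (convex_ball 0 r).segment_subset hsu hsv
  have hcont : ContinuousOn (fun w => F (φ w)) (segment ℝ (s • u') (s • v')) :=
    hF.continuous.comp_continuousOn
      (hlip.continuousOn.mono fun w hw => (hball (hsub hw)).2.2.2)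
  obtain ⟨w, hw, hFw⟩ := (convex_segment (s • u') (s • v')).isPreconnected.intermediate_value
    (right_mem_segment ℝ _ _) (left_mem_segment ℝ _ _) hcont ⟨hFv.le, hFu.le⟩
  obtain ⟨hGw, hUw, hnw, -⟩ := hball (hsub hw)
  refine ⟨φ w, hUw, fun h => ?_, hGw, hFw⟩
  -- If the segment met `0` at the zero of `F`, then `a • u = -(b • v)`, and the quadratic form of
  -- `A` would agree on these vectors despite its opposite signs at `u` and `v`.
  have hw0 := hnw h
  obtain ⟨a, b, ha, hb, hab, hw⟩ := hw
  have h1 : a • s • u = -(b • s • v) := by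
    have := congrArg (Subtype.val) (hw.trans hw0)
    exact eq_neg_of_add_eq_zero_left (by simpa [u', v'] using this)
  have h2 : A (a • s • u) (a • s • u) = A (b • s • v) (b • s • v) := by
    rw [h1]; simp
  simp only [map_smul, _root_.smul_apply, smul_eq_mul] at h2
  have h3 : a ^ 2 * (s ^ 2 * A u u) = b ^ 2 * (s ^ 2 * A v v) := by linarith
  have h4 : 0 < s ^ 2 * A u u := by positivity
  have h5 : s ^ 2 * A v v < 0 := mul_neg_of_pos_of_neg (by positivity) hvneg
  rcases ha.eq_or_lt with rfl | ha
  · have : b = 1 := by linarith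
    rw [this] at h3
    linarith
  · have h6 : 0 < a ^ 2 * (s ^ 2 * A u u) := by positivity
    have h7 : b ^ 2 * (s ^ 2 * A v v) ≤ 0 := mul_nonpos_of_nonneg_of_nonpos (by positivity) h5.le
    linarith

/-- Inner products with linearly independent vectors can be prescribed arbitrarily. -/
lemma LinearIndependent.range_pi_innerSL {E : Type*} [NormedAddCommGroup E]
    [InnerProductSpace ℝ E] [FiniteDimensional ℝ E] {ι : Type*} [Fintype ι]
    {a : ι → E} (ha : LinearIndependent ℝ a) :
    (ContinuousLinearMap.pi fun i => innerSL ℝ (a i)).range = ⊤ := by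
  classical
  -- `T` sends coefficients to combinations of the `a i`. It is injective, so its adjoint, whose
  -- coordinates are the inner products with the `a i`, is surjective.
  let T : EuclideanSpace ℝ ι →ₗ[ℝ] E :=
    Fintype.linearCombination ℝ a ∘ₗ (WithLp.linearEquiv 2 ℝ (ι → ℝ)).toLinearMap
  have hker : T.ker = ⊥ := by
    rw [LinearMap.ker_eq_bot]
    exact ha.fintypeLinearCombination_injective.comp (WithLp.linearEquiv 2 ℝ (ι → ℝ)).injective
  have hrange : T.adjoint.range = ⊤ := by
    rw [← LinearMap.orthogonal_ker, hker, Submodule.bot_orthogonal_eq_top]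
  rw [LinearMap.range_eq_top] at hrange ⊢
  intro c
  obtain ⟨v, hv⟩ := hrange (WithLp.toLp 2 c)
  refine ⟨v, funext fun i => ?_⟩
  have h1 : inner ℝ (EuclideanSpace.single i (1 : ℝ)) (T.adjoint v) = c i := by
    rw [hv]; simp [EuclideanSpace.inner_single_left]
  rw [LinearMap.adjoint_inner_right] at h1
  have h2 : T (EuclideanSpace.single i 1) = a i := by
    simp [T]
  rw [h2] at h1
  simpa using h1

end Analysis

/-! ### Smoothness of `h` and corner masses of `B(x)`. -/

namespace FinPerm

open Finset Filter Topology

lemma contDiff_bMatrix_apply (n : ℕ) (a b : Fin n) :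
    ContDiff ℝ 2 fun x : Param n => bMatrix n x a b := by
  simp only [bMatrix, Matrix.add_apply, Matrix.sum_apply, Matrix.smul_apply, smul_eq_mul]
  fun_prop

lemma contDiff_h (n : ℕ) (σ : FinPerm) : ContDiff ℝ 2 (h n σ) := by
  unfold h
  refine contDiff_const.add (contDiff_const.mul (ContDiff.sum fun f _ => ContDiff.sum fun g _ => ?_))
  exact (contDiff_prod fun i _ => contDiff_bMatrix_apply n _ _).div_const _

lemma dotProduct_hessian_mulVec {ι : Type} [Fintype ι] [DecidableEq ι]
    (F : EuclideanSpace ℝ ι → ℝ) (x w : EuclideanSpace ℝ ι) :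
    w.ofLp ⬝ᵥ Matrix.mulVec (hessian F x) w.ofLp = fderiv ℝ (fderiv ℝ F) x w w := by
  set A := fderiv ℝ (fderiv ℝ F) x with hA
  have hw : w = ∑ p, w p • EuclideanSpace.single p (1 : ℝ) := by
    ext q
    simp [Finset.sum_apply, Pi.single_apply]
  conv_rhs => rw [hw]
  simp only [map_sum, map_smul, _root_.smul_apply, _root_.sum_apply, smul_eq_mul, dotProduct,
    Matrix.mulVec, hessian, Matrix.of_apply, ← hA]
  simp_rw [Finset.mul_sum]
  rw [Finset.sum_comm]
  refine Finset.sum_congr rfl fun p _ => Finset.sum_congr rfl fun q _ => by ring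

/-- `Z^{j,j'}` is the rank-one product of `e_j - e_{j+1}` and `e_{j'} - e_{j'+1}`, so its sum over a
product set factors. -/
lemma sum_ite_zMatrix {n : ℕ} (p : Fin (n - 1) × Fin (n - 1)) (P Q : Fin n → Prop)
    [DecidablePred P] [DecidablePred Q] :
    ∑ a, ∑ b, (if P a ∧ Q b then zMatrix n p.1 p.2 a b else 0) =
      ((if P ⟨p.1, by omega⟩ then 1 else 0) - (if P ⟨p.1 + 1, by omega⟩ then 1 else 0)) *
      ((if Q ⟨p.2, by omega⟩ then 1 else 0) - (if Q ⟨p.2 + 1, by omega⟩ then 1 else 0)) := by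
  let u : Fin (n - 1) → Fin n → ℝ := fun j i =>
    (if i = ⟨j, by omega⟩ then 1 else 0) - (if i = ⟨j + 1, by omega⟩ then 1 else 0)
  have hz : ∀ a b, zMatrix n p.1 p.2 a b = u p.1 a * u p.2 b := by
    intro a b
    simp only [zMatrix, Matrix.of_apply, u, Fin.ext_iff]
    split_ifs <;> first | omega | norm_num
  have hu : ∀ (j : Fin (n - 1)) (R : Fin n → Prop) [DecidablePred R],
      ∑ a, (if R a then u j a else 0) =
        (if R ⟨j, by omega⟩ then 1 else 0) - (if R ⟨j + 1, by omega⟩ then 1 else 0) := by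
    intro j R _
    have : ∀ a, (if R a then u j a else 0) =
        (if a = ⟨j, by omega⟩ then (if R a then (1 : ℝ) else 0) else 0) -
          (if a = ⟨j + 1, by omega⟩ then (if R a then (1 : ℝ) else 0) else 0) := by
      intro a
      simp only [u]
      split_ifs <;> simp
    simp_rw [this, Finset.sum_sub_distrib, Finset.sum_ite_eq', mem_univ, if_true]
  rw [← hu p.1 P, ← hu p.2 Q, Finset.sum_mul_sum]
  refine Finset.sum_congr rfl fun a _ => Finset.sum_congr rfl fun b _ => ?_
  rw [hz, ite_and]
  split_ifs <;> simp

/-- Taking `P` or `Q` constantly true or an initial segment yields the total mass, the marginals and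
the corner masses at once. -/
lemma sum_ite_bMatrix {n : ℕ} (x : Param n) (P Q : Fin n → Prop)
    [DecidablePred P] [DecidablePred Q] :
    ∑ a, ∑ b, (if P a ∧ Q b then bMatrix n x a b else 0) =
      #{a | P a} * #{b | Q b} + ∑ p : Fin (n - 1) × Fin (n - 1), x p *
      (((if P ⟨p.1, by omega⟩ then 1 else 0) - (if P ⟨p.1 + 1, by omega⟩ then 1 else 0)) *
      ((if Q ⟨p.2, by omega⟩ then 1 else 0) - (if Q ⟨p.2 + 1, by omega⟩ then 1 else 0))) := by
  have h1 : ∀ a b, (if P a ∧ Q b then bMatrix n x a b else 0) =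
      (if P a then 1 else 0) * (if Q b then 1 else 0) +
        ∑ p : Fin (n - 1) × Fin (n - 1), x p * (if P a ∧ Q b then zMatrix n p.1 p.2 a b else 0) := by
    intro a b
    by_cases hP : P a <;> by_cases hQ : Q b <;> simp [hP, hQ, bMatrix, Matrix.sum_apply]
  simp_rw [h1, Finset.sum_add_distrib]
  congr 1
  · rw [← Finset.sum_mul_sum, Finset.sum_boole, Finset.sum_boole]
  · simp_rw [← sum_ite_zMatrix, Finset.mul_sum]
    rw [Finset.sum_comm]
    simp_rw [fun b : Fin n => Finset.sum_comm (s := (univ : Finset (Fin n)))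
      (t := (univ : Finset (Fin (n - 1) × Fin (n - 1)))) (f := fun a p => x p *
        (if P a ∧ Q b then zMatrix n p.1 p.2 a b else 0))]
    rw [Finset.sum_comm]
    refine Finset.sum_congr rfl fun p _ => Finset.sum_comm

lemma sum_bMatrix {n : ℕ} (x : Param n) : ∑ a, ∑ b, bMatrix n x a b = (n : ℝ) ^ 2 := by
  have := sum_ite_bMatrix x (fun _ => True) (fun _ => True)
  simpa [sq] using this

/-- Grid permutations of a matrix `bMatrix n x` with `x ≠ 0` are not quasirandom. -/
lemma not_isQuasirandom_grid_bMatrix {n : ℕ} (hn : 0 < n) {x : Param n} (hx : x ≠ 0)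
    (hB : ∀ a b, 0 ≤ bMatrix n x a b)
    {τ : ∀ t, Equiv.Perm (Fin (Fintype.card (GridPoint (floorMatrix (bMatrix n x) t) t)))}
    {e : ∀ t, Fin (Fintype.card (GridPoint (floorMatrix (bMatrix n x) t) t)) ≃
      GridPoint (floorMatrix (bMatrix n x) t) t}
    (hτ : ∀ t, IsGridPerm _ t (τ t) (e t)) : ¬ IsQuasirandom fun t => ⟨_, τ t⟩ := by
  obtain ⟨⟨j, j'⟩, hj⟩ : ∃ p, x p ≠ 0 := by
    by_contra! h
    exact hx (PiLp.ext h)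
  let J : Fin n := ⟨j, by omega⟩
  let J' : Fin n := ⟨j', by omega⟩
  have hcard : ∀ J : Fin n, (#{a | a ≤ J} : ℝ) = (J : ℝ) + 1 := by
    intro J
    have : ({a | a ≤ J} : Finset (Fin n)) = Finset.Iic J := by ext; simp
    rw [this, Fin.card_Iic]
    push_cast; rfl
  have hR := sum_ite_bMatrix x (fun a => a ≤ J) (fun _ => True)
  have hC := sum_ite_bMatrix x (fun _ => True) (fun b => b ≤ J')
  have hS := sum_ite_bMatrix x (fun a => a ≤ J) (fun b => b ≤ J')
  simp only [and_true, true_and, if_true, sub_self, mul_zero, zero_mul, Finset.sum_const_zero,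
    add_zero, hcard, Finset.filter_true, Finset.card_univ, Fintype.card_fin] at hR hC hS
  -- A threshold at `i` separates `i'` from `i' + 1` only for `i' = i`. So the corner at `(j, j')`
  -- sees the single coordinate `x (j, j')`, while the marginals see none.
  have hind : ∀ i i' : Fin (n - 1), ((if (⟨i', by omega⟩ : Fin n) ≤ ⟨i, by omega⟩ then 1 else 0) -
      (if (⟨i' + 1, by omega⟩ : Fin n) ≤ ⟨i, by omega⟩ then 1 else 0) : ℝ) =
      if i' = i then 1 else 0 := by
    intro i i'
    simp only [Fin.mk_le_mk, Fin.ext_iff]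
    split_ifs <;> first | omega | norm_num
  have hdiag : ∑ p : Fin (n - 1) × Fin (n - 1), x p *
      (((if (⟨p.1, by omega⟩ : Fin n) ≤ J then 1 else 0) -
        (if (⟨p.1 + 1, by omega⟩ : Fin n) ≤ J then 1 else 0)) *
      ((if (⟨p.2, by omega⟩ : Fin n) ≤ J' then 1 else 0) -
        (if (⟨p.2 + 1, by omega⟩ : Fin n) ≤ J' then 1 else 0))) = x (j, j') := by
    simp only [J, J', hind, Fintype.sum_prod_type]
    rw [Finset.sum_eq_single j (by intro b _ hb; simp [hb]) (by simp),
      Finset.sum_eq_single j' (by intro b _ hb; simp [hb]) (by simp)]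
    simp
  rw [hdiag] at hS
  refine not_isQuasirandom_grid hn hB (sum_bMatrix x) hτ hR hC hS (by positivity) (by positivity) ?_
  have : (n : ℝ) ^ 2 * (((J : ℝ) + 1) * ((J' : ℝ) + 1) + x (j, j')) -
      ((J : ℝ) + 1) * n * (n * ((J' : ℝ) + 1)) = (n : ℝ) ^ 2 * x (j, j') := by ring
  rw [this]
  positivity

/-- A common zero `x ≠ 0` of the functions `h n (π i)` with `bMatrix n x` nonnegative shows that
the permutations `π i` do not force quasirandomness. -/
lemma not_quasirandomForcing_of_common_zero {ι : Type*} {n : ℕ} (hn : 0 < n) (π : ι → FinPerm)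
    {x : Param n} (hx : x ≠ 0) (hB : ∀ a b, 0 ≤ bMatrix n x a b) (hh : ∀ i, h n (π i) x = 0) :
    ¬ QuasirandomForcing (Set.range π) := by
  intro hforce
  choose τ e hτ using fun t => exists_isGridPerm (floorMatrix (bMatrix n x) t) t
  refine not_isQuasirandom_grid_bMatrix hn hx hB hτ
    ((hforce _ (tendsto_card_gridPoint hn hB (sum_bMatrix x))).2 ?_)
  rintro _ ⟨i, rfl⟩
  rw [← stepDensity_eq_of_h_eq_zero hn (π i) x (hh i)]
  exact tendsto_density_grid hn hB (sum_bMatrix x) hτ (π i).2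

lemma eventually_bMatrix_nonneg (n : ℕ) :
    ∀ᶠ x : Param n in 𝓝 0, ∀ a b, 0 ≤ bMatrix n x a b := by
  simp only [Filter.eventually_all]
  intro a b
  have h1 : Tendsto (fun x : Param n => bMatrix n x a b) (𝓝 0) (𝓝 1) := by
    have := (contDiff_bMatrix_apply n a b).continuous.tendsto 0
    simpa [bMatrix_zero] using this
  exact (h1.eventually_const_lt one_pos).mono fun x hx => hx.le

lemma inner_gradient_h (n : ℕ) (σ : FinPerm) (v : Param n) :
    inner ℝ (gradient (h n σ) 0) v = fderiv ℝ (h n σ) 0 v := by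
  simp [gradient, InnerProductSpace.toDual_symm_apply]

end FinPerm

/-! ### The theorem. -/

theorem mainTheorem4 (k n : ℕ) (π : Fin k → FinPerm)
    (hn : k + 2 ≤ (n - 1) ^ 2)
    (hindep : LinearIndependent ℝ (fun i : Fin (k - 1) =>
      gradient (FinPerm.h n (π (Fin.castLE (Nat.sub_le k 1) i))) 0))
    (α : Fin k → ℝ) (hα : ∃ i, α i ≠ 0)
    (hdep : ∑ i : Fin k, α i • gradient (FinPerm.h n (π i)) 0 = 0)
    (wpos wneg : FinPerm.Param n)
    (hwpos_orth : ∀ i : Fin (k - 1),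
      inner ℝ wpos (gradient (FinPerm.h n (π (Fin.castLE (Nat.sub_le k 1) i))) 0) = 0)
    (hwneg_orth : ∀ i : Fin (k - 1),
      inner ℝ wneg (gradient (FinPerm.h n (π (Fin.castLE (Nat.sub_le k 1) i))) 0) = 0)
    (hwpos : 0 < wpos.ofLp ⬝ᵥ
      Matrix.mulVec (∑ i : Fin k, α i • FinPerm.hessian (FinPerm.h n (π i)) 0) wpos.ofLp)
    (hwneg : wneg.ofLp ⬝ᵥ
      Matrix.mulVec (∑ i : Fin k, α i • FinPerm.hessian (FinPerm.h n (π i)) 0) wneg.ofLp < 0) :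
    ¬ FinPerm.QuasirandomForcing (Set.range π) := by
  have hn0 : 0 < n := by
    rcases Nat.eq_zero_or_pos n with rfl | h
    · simp at hn
    · exact h
  obtain ⟨k, rfl⟩ : ∃ k', k = k' + 1 := by
    obtain ⟨i, -⟩ := hα
    exact ⟨k - 1, by have := i.2; omega⟩
  have hindep : LinearIndependent ℝ fun i : Fin k =>
    gradient (FinPerm.h n (π i.castSucc)) 0 := hindep
  have hwpos_orth : ∀ i : Fin k,
    inner ℝ wpos (gradient (FinPerm.h n (π i.castSucc)) 0) = 0 := hwpos_orth
  have hwneg_orth : ∀ i : Fin k,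
    inner ℝ wneg (gradient (FinPerm.h n (π i.castSucc)) 0) = 0 := hwneg_orth
  -- Otherwise the dependence would involve only the independent gradients, forcing all `α i` to
  -- vanish.
  have hlast : α (Fin.last k) ≠ 0 := by
    intro h0
    rw [Fin.sum_univ_castSucc, h0, zero_smul, add_zero] at hdep
    have h1 := Fintype.linearIndependent_iff.1 hindep _ hdep
    obtain ⟨i, hi⟩ := hα
    induction i using Fin.lastCases with
    | last => exact hi h0
    | cast i => exact hi (h1 i)
  let F : FinPerm.Param n → ℝ := fun x => ∑ i, α i * FinPerm.h n (π i) x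
  have hsmooth : ∀ i, ContDiff ℝ 2 (FinPerm.h n (π i)) := fun i => FinPerm.contDiff_h n (π i)
  have hdiff : ∀ i x, DifferentiableAt ℝ (FinPerm.h n (π i)) x := fun i x =>
    ((hsmooth i).differentiable (by norm_num)).differentiableAt
  have hF : ContDiff ℝ 2 F := ContDiff.sum fun i _ => contDiff_const.mul (hsmooth i)
  have hfd : fderiv ℝ F = fun x => ∑ i, α i • fderiv ℝ (FinPerm.h n (π i)) x := by
    funext x
    exact (HasFDerivAt.fun_sum fun i _ => (hdiff i x).hasFDerivAt.const_mul (α i)).fderiv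
  have hdF : fderiv ℝ F 0 = 0 := by
    ext v
    have h1 := congrArg (fun z => inner ℝ z v) hdep
    simp only [sum_inner, real_inner_smul_left, FinPerm.inner_gradient_h, inner_zero_left] at h1
    rw [hfd]
    simpa [_root_.sum_apply] using h1
  have hquad : ∀ w : FinPerm.Param n, w.ofLp ⬝ᵥ
      Matrix.mulVec (∑ i, α i • FinPerm.hessian (FinPerm.h n (π i)) 0) w.ofLp =
        fderiv ℝ (fderiv ℝ F) 0 w w := by
    intro w
    have h2 : fderiv ℝ (fderiv ℝ F) 0 =
        ∑ i, α i • fderiv ℝ (fderiv ℝ (FinPerm.h n (π i))) 0 := by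
      rw [hfd]
      refine (HasFDerivAt.fun_sum fun i _ => HasFDerivAt.const_smul ?_ (α i)).fderiv
      exact (((hsmooth i).fderiv_right (m := 1) (by norm_num)).differentiable
        (by norm_num)).differentiableAt.hasFDerivAt
    rw [h2, Matrix.sum_mulVec, dotProduct_sum]
    simp only [Matrix.smul_mulVec, dotProduct_smul, FinPerm.dotProduct_hessian_mulVec,
      _root_.sum_apply, _root_.smul_apply]
  rw [hquad] at hwpos hwneg
  let G : FinPerm.Param n → Fin k → ℝ := fun x i => FinPerm.h n (π i.castSucc) x
  have hG : HasStrictFDerivAt G (ContinuousLinearMap.pi fun i : Fin k =>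
      innerSL ℝ (gradient (FinPerm.h n (π i.castSucc)) 0)) 0 := by
    rw [hasStrictFDerivAt_pi]
    intro i
    have h1 : innerSL ℝ (gradient (FinPerm.h n (π i.castSucc)) 0) =
        fderiv ℝ (FinPerm.h n (π i.castSucc)) 0 := by
      ext v
      simp
    rw [h1]
    exact (hsmooth _).contDiffAt.hasStrictFDerivAt (by norm_num)
  obtain ⟨x, hxB, hx0, hGx, hFx⟩ := exists_ne_zero_common_zero hG hindep.range_pi_innerSL
    (funext fun i => FinPerm.h_zero hn0 _) hF (by simp [F, FinPerm.h_zero hn0]) hdF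
    (u := wpos) (v := wneg)
    (funext fun i => by simpa [real_inner_comm] using hwpos_orth i)
    (funext fun i => by simpa [real_inner_comm] using hwneg_orth i) hwpos hwneg
    (FinPerm.eventually_bMatrix_nonneg n)
  have hGx : ∀ i : Fin k, FinPerm.h n (π i.castSucc) x = 0 := fun i => congrFun hGx i
  refine FinPerm.not_quasirandomForcing_of_common_zero hn0 π hx0 hxB fun i => ?_
  induction i using Fin.lastCases with
  | cast i => exact hGx i
  | last =>
    simp only [F, Fin.sum_univ_castSucc, hGx, mul_zero, Finset.sum_const_zero, zero_add] at hFx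
    exact (mul_eq_zero.1 hFx).resolve_left hlast
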